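/- Let $(X,d,m)$ be a metric measure space, i.e. $(X,d)$ is a complete separable metric space and $m$ is a Borel measure on $X$ that is finite on bounded sets. Let $F\subset X$ be a bounded Borel set. Then for every $\varepsilon>0$ there exists a closed set $G\subset X$ such that $m(F\,\Delta\,G)<\varepsilon$ and such that extension by zero is a bounded operator from $BV(G)$ to $BV(X)$: there is a constant $C<\infty$ such that for every $f\in BV(G)$ the function $\tilde f$ that equals $f$ on $G$ and $0$ on $X\setminus G$ belongs to $BV(X)$ and satisfies $\|\tilde f\|_{BV(X)}\le C\,\|f\|_{BV(G)}$. Here, for a Borel measure $\mu$ on $X$ that is finite on bounded sets, $f\in L^1_{\rm loc}(\mu)$, and an open set $A\subset X$, $$|Df|_{\mu}(A)=\inf\Big\{\liminf_{n\to\infty}\int_A {\rm lip}_a(f_n)\,d\mu \;:\; f_n \text{ locally Lipschitz on } A,\ f_n\to f \text{ in } L^1_{\rm loc}(\mu|_A)\Big\},$$ where ${\rm lip}_a(g)(x)=\inf_{r>0}{\rm Lip}(g|_{B_r(x)})$ is the asymptotic Lipschitz constant, and convergence in $L^1_{\rm loc}(\mu|_A)$ means that every point of $A$ has a neighbourhood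 on which the convergence holds in $L^1(\mu|_A)$. For a Borel set $B\subset X$, $|Df|_{\mu}(B)=\inf\{|Df|_{\mu}(A): A\supset B \text{ open}\}$. Finally, for $B\subset X$ Borel, write $m|_B$ for the restriction of $m$ to $B$; $BV(B)$ is the space of all $f\in L^1(m|_B)$ with $|Df|_{m|_B}(B)<\infty$, with norm $\|f\|_{BV(B)}=\|f\|_{L^1(m|_B)}+|Df|_{m|_B}(B)$. -/

import Mathlib

open Set Filter Topology MeasureTheory
open scoped NNReal ENNReal

noncomputable section

namespace MetricBV

variable {X : Type*} [MetricSpace X]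

/-- The Lipschitz constant `Lip(f; s)` of `f` restricted to `s`
(it is `∞` if `f` is not Lipschitz on `s`). -/
def lipConst (f : X → ℝ) (s : Set X) : ℝ≥0∞ :=
  ⨅ (K : ℝ≥0) (_ : LipschitzOnWith K f s), (K : ℝ≥0∞)

/-- The asymptotic Lipschitz constant `lip_a(f)(x) = inf_{r > 0} Lip(f; B_r(x))`.
If `f` is locally Lipschitz on an open set `A`, then its values on `A` are finite and depend only
on the values of `f` on `A`. -/
def asympLip (f : X → ℝ) (x : X) : ℝ≥0∞ :=
  ⨅ (r : ℝ) (_ : 0 < r), lipConst f (Metric.ball x r)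

variable [MeasurableSpace X]

/-- Convergence `u n → f` in `L¹_loc(μ|_A)`: every point of `A` has a neighbourhood `U` such that
`u n → f` in `L¹(U ∩ A, μ)`. -/
def TendstoL1Loc (μ : Measure X) (A : Set X) (u : ℕ → X → ℝ) (f : X → ℝ) : Prop :=
  ∀ x ∈ A, ∃ U ∈ 𝓝 x, Tendsto (fun n => ∫⁻ y in U ∩ A, ‖u n y - f y‖ₑ ∂μ) atTop (𝓝 0)

/-- The total variation `|Df|(A)` of `f` on an open set `A`, computed in the metric measure space
`(X, d, μ)`: the infimum of `liminf ∫_A lip_a(u n) dμ` over all sequences of functions that are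
locally Lipschitz on `A` and converge to `f` in `L¹_loc(μ|_A)`. -/
def variationOpen (μ : Measure X) (f : X → ℝ) (A : Set X) : ℝ≥0∞ :=
  ⨅ (u : ℕ → X → ℝ) (_ : ∀ n, LocallyLipschitzOn A (u n)) (_ : TendstoL1Loc μ A u f),
    liminf (fun n => ∫⁻ x in A, asympLip (u n) x ∂μ) atTop

/-- The total variation `|Df|(B)` of `f` on a Borel set `B`, computed in the metric measure space
`(X, d, μ)`: the infimum of `|Df|(A)` over all open sets `A ⊇ B`. -/
def variation (μ : Measure X) (f : X → ℝ) (B : Set X) : ℝ≥0∞ :=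
  ⨅ (A : Set X) (_ : IsOpen A) (_ : B ⊆ A), variationOpen μ f A

/-- `f` represents an element of `BV(B)`: `f ∈ L¹(m|_B)` and `|Df|_B(B) < ∞`, where `|Df|_B` is
computed in the metric measure space `(X, d, m|_B)`. -/
structure MemBV (m : Measure X) (B : Set X) (f : X → ℝ) : Prop where
  integrable : Integrable f (m.restrict B)
  variation_lt_top : variation (m.restrict B) f B < ∞

/-- The norm `‖f‖_{BV(B)} = ‖f‖_{L¹(m|_B)} + |Df|_B(B)`. -/
def bvNorm (m : Measure X) (B : Set X) (f : X → ℝ) : ℝ≥0∞ :=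
  eLpNorm f 1 (m.restrict B) + variation (m.restrict B) f B

/-- Extension by zero is a bounded operator from `BV(G)` to `BV(X)`. -/
def ZeroExtensionBounded (m : Measure X) (G : Set X) : Prop :=
  ∃ C : ℝ≥0, ∀ f : X → ℝ, MemBV m G f →
    MemBV m univ (G.indicator f) ∧ bvNorm m univ (G.indicator f) ≤ C * bvNorm m G f

end MetricBV

end

/-! The cost of extending by zero is the jump across the boundary of `G`, so `G` is chosen such that
its perimeter cannot be lowered cheaply by removing mass. Let P(E) be the L¹-relaxation of ∫ lip_a
at the indicator of E. Inside F lies a closed K of almost full measure, and the coarea inequality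
`exists_lintegral_le_liminf_energy`, applied to a function of the distance to K, gives a closed G₀ ⊇
K with P(G₀) < ∞ and nearly the same measure. Inside G₀, `exists_isClosed_minimizer` finds a closed
G with c·m(G₀ \ G) ≤ P(G₀), which is small removed mass for large c, and with P(G) ≤ P(G') + c·m(G \
G') for all closed G' ⊆ G.

Such a G admits zero extension. Let 0 ≤ u ≤ M be locally Lipschitz around G, and let ρ_n → χ_G with
energies at most P(G) + o(1). By the product rule the energies of uρ_n and (M - u)ρ_n add up to at
most M·P(G) + 2∫_G lip_a(u) + o(1), because u + (M - u) = M. Conversely, coarea bounds the integral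
over 0 < s < M of P(G ∩ {u ≤ s}) by the liminf of the energies of (M - u)ρ_n, and minimality turns
this into M·P(G) ≤ liminf + c∫_G u (`perimeter_le_liminf_energy_add`). Subtracting, M·P(G) cancels:
the relaxed energy of uχ_G is at most 2∫_G lip_a(u) + c∫_G u, with no M left
(`relaxedEnergy_indicator_le_of_nonneg`). Splitting into positive and negative parts and truncating
then reaches all of BV(G).

One difficulty remains: u is controlled only on some open A ⊇ G, with Lipschitz constants that are
merely locally bounded. Hence a cutoff is inserted, and ρ_n must converge in L¹ with a locally
bounded weight; `exists_energy_le_weighted` obtains this by gluing approximants along dyadic layers.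
-/

namespace MetricBV

/-! ### Calculus of the asymptotic Lipschitz constant -/

section asympLip

variable {X : Type*} [MetricSpace X] {u v : X → ℝ} {x : X}

theorem asympLip_le {K : ℝ≥0} (h : ∀ᶠ p : X × X in 𝓝 (x, x), |u p.1 - u p.2| ≤ K * dist p.1 p.2) :
    asympLip u x ≤ K := by
  rw [nhds_prod_eq, (Metric.nhds_basis_ball.prod_self).eventually_iff] at h
  obtain ⟨r, hr, h⟩ := h
  refine (iInf₂_le r hr).trans (iInf₂_le K ?_)
  refine LipschitzOnWith.of_dist_le_mul fun y hy z hz => ?_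
  simpa [Real.dist_eq] using h (mk_mem_prod hy hz)

theorem eventually_of_asympLip_lt {K : ℝ≥0} (h : asympLip u x < K) :
    ∀ᶠ p : X × X in 𝓝 (x, x), |u p.1 - u p.2| ≤ K * dist p.1 p.2 := by
  simp only [asympLip, lipConst, iInf_lt_iff] at h
  obtain ⟨r, hr, L, hL, hLK⟩ := h
  have hLK : L ≤ K := by exact_mod_cast hLK.le
  rw [nhds_prod_eq, (Metric.nhds_basis_ball.prod_self).eventually_iff]
  refine ⟨r, hr, fun p hp => ?_⟩
  have := (hL.weaken hLK).dist_le_mul p.1 hp.1 p.2 hp.2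
  simpa [Real.dist_eq] using this

theorem continuousAt_of_asympLip_ne_top (h : asympLip u x ≠ ∞) : ContinuousAt u x := by
  obtain ⟨K, hK⟩ := ENNReal.lt_iff_exists_nnreal_btwn.1 h.lt_top
  have h1 : ∀ᶠ y in 𝓝 x, |u y - u x| ≤ K * dist y x := by
    have h2 : Tendsto (fun y => (y, x)) (𝓝 x) (𝓝 (x, x)) :=
      (Continuous.prodMk_left x).tendsto' _ _ rfl
    exact h2.eventually (eventually_of_asympLip_lt hK.1)
  rw [ContinuousAt, tendsto_iff_dist_tendsto_zero]
  refine squeeze_zero' (Eventually.of_forall fun _ => dist_nonneg)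
    (by simpa [Real.dist_eq] using h1) ?_
  have : Continuous fun y => (K : ℝ) * dist y x := by fun_prop
  exact this.tendsto' _ _ (by simp)

theorem continuous_of_asympLip_ne_top (h : ∀ x, asympLip u x ≠ ∞) : Continuous u :=
  continuous_iff_continuousAt.2 fun x => continuousAt_of_asympLip_ne_top (h x)

theorem locallyLipschitz_of_asympLip_ne_top (h : ∀ x, asympLip u x ≠ ∞) : LocallyLipschitz u := by
  intro x
  have h := (h x).lt_top
  simp only [asympLip, lipConst, iInf_lt_iff] at h
  obtain ⟨r, hr, L, hL, -⟩ := h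
  exact ⟨L, _, Metric.ball_mem_nhds x hr, hL⟩

theorem asympLip_ne_top_of_locallyLipschitzOn {A : Set X} (hA : IsOpen A)
    (h : LocallyLipschitzOn A u) (hx : x ∈ A) : asympLip u x ≠ ∞ := by
  obtain ⟨K, t, ht, hK⟩ := h hx
  rw [hA.nhdsWithin_eq hx] at ht
  obtain ⟨r, hr, hrt⟩ := Metric.mem_nhds_iff.1 ht
  refine ne_top_of_le_ne_top ENNReal.coe_ne_top
    ((iInf₂_le r hr).trans (iInf₂_le K (hK.mono hrt)))

theorem asympLip_le_of_lipschitzWith {K : ℝ≥0} (h : LipschitzWith K u) (x : X) :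
    asympLip u x ≤ K :=
  (iInf₂_le 1 one_pos).trans (iInf₂_le K h.lipschitzOnWith)

/-- A ball around `x` contains the balls of half its radius around nearby points. This yields both
measurability and local boundedness of `asympLip u`. -/
theorem upperSemicontinuous_asympLip (u : X → ℝ) : UpperSemicontinuous (asympLip u) := by
  intro x c hc
  simp only [asympLip, iInf_lt_iff] at hc
  obtain ⟨r, hr, hc⟩ := hc
  filter_upwards [Metric.ball_mem_nhds x (half_pos hr)] with y hy
  refine lt_of_le_of_lt ((iInf₂_le (r / 2) (half_pos hr)).trans ?_) hc
  refine iInf_mono fun K => iInf_mono' fun hK => ⟨hK.mono ?_, le_rfl⟩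
  exact Metric.ball_subset_ball' (by rw [Metric.mem_ball] at hy; linarith)

theorem measurable_asympLip [MeasurableSpace X] [BorelSpace X] (u : X → ℝ) :
    Measurable (asympLip u) :=
  (upperSemicontinuous_asympLip u).measurable

theorem asympLip_mono_of_eventually
    (h : ∀ᶠ p : X × X in 𝓝 (x, x), |u p.1 - u p.2| ≤ |v p.1 - v p.2|) :
    asympLip u x ≤ asympLip v x := by
  refine ENNReal.le_of_forall_pos_le_add fun ε hε hv => ?_
  lift asympLip v x to ℝ≥0 using hv.ne with a ha
  have := eventually_of_asympLip_lt (u := v) (x := x) (K := a + ε)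
    (by rw [← ha]; exact_mod_cast lt_add_of_pos_right a hε)
  refine (asympLip_le (K := a + ε) ?_).trans (by simp)
  filter_upwards [h, this] with p h1 h2 using h1.trans h2

theorem asympLip_congr (h : u =ᶠ[𝓝 x] v) : asympLip u x = asympLip v x := by
  have h2 : ∀ᶠ p : X × X in 𝓝 (x, x), u p.1 = v p.1 ∧ u p.2 = v p.2 := by
    rw [nhds_prod_eq]; exact h.prod_mk h
  refine le_antisymm (asympLip_mono_of_eventually ?_) (asympLip_mono_of_eventually ?_) <;>
  · filter_upwards [h2] with p hp
    rw [hp.1, hp.2]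

@[simp] theorem asympLip_const (c : ℝ) (x : X) : asympLip (fun _ => c) x = 0 :=
  le_antisymm (by simpa using asympLip_le (u := fun _ : X => c) (x := x) (K := 0) (by simp)) bot_le

theorem asympLip_eq_zero_of_eventuallyEq_const {c : ℝ} (h : u =ᶠ[𝓝 x] fun _ => c) :
    asympLip u x = 0 := by
  rw [asympLip_congr h, asympLip_const]

theorem asympLip_add_le (u v : X → ℝ) (x : X) :
    asympLip (fun y => u y + v y) x ≤ asympLip u x + asympLip v x := by
  refine ENNReal.le_of_forall_pos_le_add fun ε hε h => ?_
  rw [ENNReal.add_lt_top] at h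
  lift asympLip u x to ℝ≥0 using h.1.ne with a ha
  lift asympLip v x to ℝ≥0 using h.2.ne with b hb
  have h1 := eventually_of_asympLip_lt (u := u) (x := x) (K := a + ε / 2)
    (by rw [← ha]; exact_mod_cast lt_add_of_pos_right a (half_pos hε))
  have h2 := eventually_of_asympLip_lt (u := v) (x := x) (K := b + ε / 2)
    (by rw [← hb]; exact_mod_cast lt_add_of_pos_right b (half_pos hε))
  refine (asympLip_le (K := a + b + ε) ?_).trans (by simp)
  filter_upwards [h1, h2] with p h1 h2
  have : |u p.1 + v p.1 - (u p.2 + v p.2)| ≤ |u p.1 - u p.2| + |v p.1 - v p.2| := by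
    rw [add_sub_add_comm]; exact abs_add_le _ _
  push_cast at *
  linarith

theorem asympLip_neg (u : X → ℝ) (x : X) : asympLip (fun y => -u y) x = asympLip u x :=
  le_antisymm
    (asympLip_mono_of_eventually <| Eventually.of_forall fun p => by
      rw [← abs_neg]; apply le_of_eq; congr 1; ring)
    (asympLip_mono_of_eventually <| Eventually.of_forall fun p => by
      rw [← abs_neg]; apply le_of_eq; congr 1; ring)

theorem asympLip_sum_le {ι : Type*} (s : Finset ι) (w : ι → X → ℝ) (x : X) :
    asympLip (fun y => ∑ i ∈ s, w i y) x ≤ ∑ i ∈ s, asympLip (w i) x := by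
  classical
  induction s using Finset.induction_on with
  | empty => simp
  | insert i s hi ih =>
    simp only [Finset.sum_insert hi]
    exact (asympLip_add_le _ _ _).trans (by gcongr)

theorem asympLip_comp_le {K : ℝ≥0} {φ : ℝ → ℝ} (hφ : LipschitzWith K φ) (u : X → ℝ) (x : X)
    (hu : asympLip u x ≠ ∞) :
    asympLip (fun y => φ (u y)) x ≤ K * asympLip u x := by
  lift asympLip u x to ℝ≥0 using hu with a ha
  -- The infimum defining `asympLip` need not be attained, hence the slack `η`, removed by a limit.
  have key : ∀ η : ℝ≥0, 0 < η → asympLip (fun y => φ (u y)) x ≤ ((K * (a + η) : ℝ≥0) : ℝ≥0∞) := by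
    intro η hη
    have h1 := eventually_of_asympLip_lt (u := u) (x := x) (K := a + η)
      (by rw [← ha]; exact_mod_cast lt_add_of_pos_right a hη)
    refine asympLip_le ?_
    filter_upwards [h1] with p h1
    have := hφ.dist_le_mul (u p.1) (u p.2)
    rw [Real.dist_eq, Real.dist_eq] at this
    push_cast at *
    nlinarith [mul_le_mul_of_nonneg_left h1 K.2]
  have ht : Tendsto (fun η : ℝ≥0 => ((K * (a + η) : ℝ≥0) : ℝ≥0∞)) (𝓝[>] 0)
      (𝓝 ((K * (a + 0) : ℝ≥0) : ℝ≥0∞)) := by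
    refine ENNReal.tendsto_coe.2 (Tendsto.mono_left ?_ nhdsWithin_le_nhds)
    exact Continuous.tendsto (by fun_prop) 0
  have := ge_of_tendsto ht (eventually_nhdsWithin_of_forall fun η hη => key η hη)
  simpa using this

theorem asympLip_mul_le (hu : asympLip u x ≠ ∞) (hv : asympLip v x ≠ ∞) :
    asympLip (fun y => u y * v y) x ≤ ‖u x‖ₑ * asympLip v x + ‖v x‖ₑ * asympLip u x := by
  have cu := (continuousAt_of_asympLip_ne_top hu).nnnorm
  have cv := (continuousAt_of_asympLip_ne_top hv).nnnorm
  lift asympLip u x to ℝ≥0 using hu with a ha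
  lift asympLip v x to ℝ≥0 using hv with b hb
  have key : ∀ η : ℝ≥0, 0 < η → asympLip (fun y => u y * v y) x ≤
      (((‖u x‖₊ + η) * (b + η) + (‖v x‖₊ + η) * (a + η) : ℝ≥0) : ℝ≥0∞) := by
    intro η hη
    have h1 := eventually_of_asympLip_lt (u := u) (x := x) (K := a + η)
      (by rw [← ha]; exact_mod_cast lt_add_of_pos_right a hη)
    have h2 := eventually_of_asympLip_lt (u := v) (x := x) (K := b + η)
      (by rw [← hb]; exact_mod_cast lt_add_of_pos_right b hη)
    have h3 : ∀ᶠ y in 𝓝 x, ‖u y‖₊ < ‖u x‖₊ + η :=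
      cu.eventually_lt continuousAt_const (lt_add_of_pos_right _ hη)
    have h4 : ∀ᶠ y in 𝓝 x, ‖v y‖₊ < ‖v x‖₊ + η :=
      cv.eventually_lt continuousAt_const (lt_add_of_pos_right _ hη)
    have h5 : ∀ᶠ p : X × X in 𝓝 (x, x), ‖u p.1‖₊ < ‖u x‖₊ + η ∧ ‖v p.2‖₊ < ‖v x‖₊ + η := by
      rw [nhds_prod_eq]; exact h3.prod_mk h4
    refine asympLip_le ?_
    filter_upwards [h1, h2, h5] with p h1 h2 h5
    obtain ⟨h5, h6⟩ := h5
    have h5 : |u p.1| ≤ |u x| + η := by exact_mod_cast h5.le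
    have h6 : |v p.2| ≤ |v x| + η := by exact_mod_cast h6.le
    have e : u p.1 * v p.1 - u p.2 * v p.2 =
      u p.1 * (v p.1 - v p.2) + v p.2 * (u p.1 - u p.2) := by ring
    rw [e]
    refine (abs_add_le _ _).trans ?_
    rw [abs_mul, abs_mul]
    have i1 := mul_le_mul h5 h2 (abs_nonneg _) (by positivity)
    have i2 := mul_le_mul h6 h1 (abs_nonneg _) (by positivity)
    push_cast at *
    simp only [Real.norm_eq_abs]
    nlinarith
  have ht : Tendsto (fun η : ℝ≥0 =>
        (((‖u x‖₊ + η) * (b + η) + (‖v x‖₊ + η) * (a + η) : ℝ≥0) : ℝ≥0∞)) (𝓝[>] 0)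
      (𝓝 (((‖u x‖₊ + 0) * (b + 0) + (‖v x‖₊ + 0) * (a + 0) : ℝ≥0) : ℝ≥0∞)) := by
    refine ENNReal.tendsto_coe.2 (Tendsto.mono_left ?_ nhdsWithin_le_nhds)
    exact Continuous.tendsto (by fun_prop) 0
  have := ge_of_tendsto ht (eventually_nhdsWithin_of_forall fun η hη => key η hη)
  simpa [enorm] using this

theorem asympLip_inv_ne_top (hu : asympLip u x ≠ ∞) (h0 : u x ≠ 0) :
    asympLip (fun y => (u y)⁻¹) x ≠ ∞ := by
  have cu := (continuousAt_of_asympLip_ne_top hu).norm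
  obtain ⟨K, hK, -⟩ := ENNReal.lt_iff_exists_nnreal_btwn.1 hu.lt_top
  have h1 := eventually_of_asympLip_lt hK
  set c : ℝ≥0 := ‖u x‖₊ / 2 with hc
  have hc0 : 0 < c := half_pos (by simpa using h0)
  have h3 : ∀ᶠ y in 𝓝 x, (c : ℝ) < ‖u y‖ := by
    refine continuousAt_const.eventually_lt cu ?_
    simp only [hc, NNReal.coe_div, coe_nnnorm, NNReal.coe_ofNat]
    linarith [norm_pos_iff.2 h0]
  have h5 : ∀ᶠ p : X × X in 𝓝 (x, x), (c : ℝ) < ‖u p.1‖ ∧ (c : ℝ) < ‖u p.2‖ := by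
    rw [nhds_prod_eq]; exact h3.prod_mk h3
  refine ne_top_of_le_ne_top ENNReal.coe_ne_top (asympLip_le (K := K * (c⁻¹ * c⁻¹)) ?_)
  filter_upwards [h1, h5] with p h1 h5
  obtain ⟨h5, h6⟩ := h5
  have hc0' : (0 : ℝ) < c := hc0
  have n1 : u p.1 ≠ 0 := norm_pos_iff.1 (hc0'.trans h5)
  have n2 : u p.2 ≠ 0 := norm_pos_iff.1 (hc0'.trans h6)
  have e : (u p.1)⁻¹ - (u p.2)⁻¹ = -(u p.1 - u p.2) * ((u p.1)⁻¹ * (u p.2)⁻¹) := by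
    field_simp; ring
  rw [e, abs_mul, abs_neg, abs_mul, abs_inv, abs_inv]
  have j1 : |u p.1|⁻¹ ≤ (c : ℝ)⁻¹ := inv_anti₀ hc0' h5.le
  have j2 : |u p.2|⁻¹ ≤ (c : ℝ)⁻¹ := inv_anti₀ hc0' h6.le
  calc |u p.1 - u p.2| * (|u p.1|⁻¹ * |u p.2|⁻¹)
      ≤ (K * dist p.1 p.2) * ((c : ℝ)⁻¹ * (c : ℝ)⁻¹) := by gcongr
    _ = _ := by push_cast; ring

end asympLip

theorem lintegral_enorm_sub_le {X : Type*} [MeasurableSpace X] {m : Measure X} {u f g : X → ℝ}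
    (hg : AEStronglyMeasurable g m) (hf : AEStronglyMeasurable f m) :
    ∫⁻ x, ‖u x - f x‖ₑ ∂m ≤ ∫⁻ x, ‖u x - g x‖ₑ ∂m + ∫⁻ x, ‖g x - f x‖ₑ ∂m := by
  refine le_trans (lintegral_mono fun x => ?_)
    (lintegral_add_right' (fun x => ‖u x - g x‖ₑ) (hg.sub hf).enorm).le
  rw [← sub_add_sub_cancel (u x) (g x) (f x)]
  exact enorm_add_le _ _

/-! ### The relaxed energy and its lower semicontinuity -/

section relaxedEnergy

variable {X : Type*} [MetricSpace X] [MeasurableSpace X]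

/-- The integral of the asymptotic Lipschitz constant. -/
noncomputable def energy (m : Measure X) (u : X → ℝ) : ℝ≥0∞ := ∫⁻ x, asympLip u x ∂m

/-- The lower semicontinuous envelope of the energy of locally Lipschitz functions with respect to
the `L¹(m)` distance. -/
noncomputable def relaxedEnergy (m : Measure X) (f : X → ℝ) : ℝ≥0∞ :=
  ⨆ (δ : ℝ≥0∞) (_ : δ ≠ 0), ⨅ (u : X → ℝ) (_ : ∀ x, asympLip u x ≠ ∞)
    (_ : ∫⁻ x, ‖u x - f x‖ₑ ∂m ≤ δ), energy m u

variable {m : Measure X} {f g : X → ℝ} {c : ℝ≥0∞}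

theorem relaxedEnergy_le (h : ∀ δ : ℝ≥0∞, δ ≠ 0 → ∃ u : X → ℝ, (∀ x, asympLip u x ≠ ∞) ∧
    ∫⁻ x, ‖u x - f x‖ₑ ∂m ≤ δ ∧ energy m u ≤ c + δ) : relaxedEnergy m f ≤ c := by
  refine iSup₂_le fun δ hδ => ENNReal.le_of_forall_pos_le_add fun ε hε _ => ?_
  obtain ⟨u, hu, hd, he⟩ := h (min δ ε) (by simp [hδ, hε.ne'])
  refine (iInf₂_le_of_le u hu (iInf_le _ (hd.trans (min_le_left _ _)))).trans (he.trans ?_)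
  gcongr
  exact min_le_right _ _

theorem exists_energy_le (hf : relaxedEnergy m f ≠ ∞) {δ : ℝ≥0∞} (hδ : δ ≠ 0) :
    ∃ u : X → ℝ, (∀ x, asympLip u x ≠ ∞) ∧ ∫⁻ x, ‖u x - f x‖ₑ ∂m ≤ δ ∧
      energy m u ≤ relaxedEnergy m f + δ := by
  have h : (⨅ (u : X → ℝ) (_ : ∀ x, asympLip u x ≠ ∞) (_ : ∫⁻ x, ‖u x - f x‖ₑ ∂m ≤ δ),
      energy m u) < relaxedEnergy m f + δ :=
    (le_iSup₂ (f := fun (δ : ℝ≥0∞) (_ : δ ≠ 0) => ⨅ (u : X → ℝ) (_ : ∀ x, asympLip u x ≠ ∞)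
      (_ : ∫⁻ x, ‖u x - f x‖ₑ ∂m ≤ δ), energy m u) δ hδ).trans_lt (ENNReal.lt_add_right hf hδ)
  simp only [iInf_lt_iff] at h
  obtain ⟨u, hu, hd, he⟩ := h
  exact ⟨u, hu, hd, he.le⟩

@[simp] theorem relaxedEnergy_zero : relaxedEnergy m (fun _ : X => (0 : ℝ)) = 0 :=
  le_antisymm (relaxedEnergy_le fun δ _ => ⟨fun _ => 0, by simp, by simp, by simp [energy]⟩) bot_le

theorem relaxedEnergy_le_liminf {u : ℕ → X → ℝ} (hu : ∀ n x, asympLip (u n) x ≠ ∞)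
    (h : Tendsto (fun n => ∫⁻ x, ‖u n x - f x‖ₑ ∂m) atTop (𝓝 0)) :
    relaxedEnergy m f ≤ liminf (fun n => energy m (u n)) atTop := by
  obtain h1 | h1 := eq_or_ne (liminf (fun n => energy m (u n)) atTop) ∞
  · rw [h1]; exact le_top
  refine relaxedEnergy_le fun δ hδ => ?_
  have h2 := frequently_lt_of_liminf_lt (f := atTop) (u := fun n => energy m (u n))
    (by isBoundedDefault) (ENNReal.lt_add_right h1 hδ)
  obtain ⟨n, hn, hn'⟩ := (h2.and_eventually (h.eventually_le_const hδ.bot_lt)).exists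
  exact ⟨u n, hu n, hn', hn.le⟩

/-- The approximants of the relaxed energy are global and converge in L¹, so they are admissible for
the variation with `A = univ`. Only this inequality is needed. -/
theorem variation_univ_le_relaxedEnergy :
    variation (m.restrict univ) f univ ≤ relaxedEnergy m f := by
  obtain h1 | h1 := eq_or_ne (relaxedEnergy m f) ∞
  · rw [h1]; exact le_top
  have h : ∀ n : ℕ, (n + 1 : ℝ≥0∞)⁻¹ ≠ 0 := fun n => by simp
  choose u hu hd he using fun n => exists_energy_le h1 (h n)
  have ht : Tendsto (fun n : ℕ => (n + 1 : ℝ≥0∞)⁻¹) atTop (𝓝 0) := by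
    have := (tendsto_add_atTop_iff_nat 1).2 ENNReal.tendsto_inv_nat_nhds_zero
    simpa using this
  have hloc : TendstoL1Loc (m.restrict univ) univ u f := fun x _ => ⟨univ, univ_mem, by
    simp only [Measure.restrict_univ, inter_self]
    exact tendsto_of_tendsto_of_tendsto_of_le_of_le tendsto_const_nhds ht (fun _ => zero_le) hd⟩
  refine (iInf₂_le univ isOpen_univ).trans ((iInf_le _ (subset_univ _)).trans ?_)
  refine (iInf₂_le u fun n =>
    (locallyLipschitz_of_asympLip_ne_top (hu n)).locallyLipschitzOn).trans
    ((iInf_le _ hloc).trans ?_)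
  simp only [Measure.restrict_univ]
  have h2 : Tendsto (fun n : ℕ => relaxedEnergy m f + (n + 1 : ℝ≥0∞)⁻¹) atTop
      (𝓝 (relaxedEnergy m f + 0)) := tendsto_const_nhds.add ht
  rw [add_zero] at h2
  rw [← h2.liminf_eq]
  exact liminf_le_liminf (Eventually.of_forall he)

/-- Lower semicontinuity in L¹, by a diagonal choice: half of the tolerance goes to `g`, half to an
approximant of `g`. -/
theorem relaxedEnergy_le_of_approx (hf : AEStronglyMeasurable f m)
    (h : ∀ δ : ℝ≥0∞, δ ≠ 0 → ∃ g : X → ℝ, AEStronglyMeasurable g m ∧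
      ∫⁻ x, ‖g x - f x‖ₑ ∂m ≤ δ ∧ relaxedEnergy m g ≤ c + δ) : relaxedEnergy m f ≤ c := by
  obtain rfl | hc := eq_or_ne c ∞
  · exact le_top
  refine relaxedEnergy_le fun δ hδ => ?_
  obtain ⟨ε, hε, hεδ⟩ : ∃ ε : ℝ≥0, ε ≠ 0 ∧ (ε : ℝ≥0∞) + ε ≤ δ := by
    obtain ⟨ε, h0, h1⟩ := ENNReal.lt_iff_exists_nnreal_btwn.1 (ENNReal.half_pos hδ)
    refine ⟨ε, by exact_mod_cast h0.ne', ?_⟩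
    calc (ε : ℝ≥0∞) + ε ≤ δ / 2 + δ / 2 := by gcongr
      _ = δ := ENNReal.add_halves δ
  have hε' : (ε : ℝ≥0∞) ≠ 0 := by exact_mod_cast hε
  obtain ⟨g, hg, hgd, hge⟩ := h ε hε'
  obtain ⟨u, hu, hd, he⟩ := exists_energy_le (m := m) (f := g)
    (ne_top_of_le_ne_top (by finiteness) hge) hε'
  refine ⟨u, hu, ?_, ?_⟩
  · exact (lintegral_enorm_sub_le hg hf).trans ((add_le_add hd hgd).trans hεδ)
  · calc energy m u ≤ c + ε + ε := he.trans (by gcongr)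
      _ ≤ c + δ := by rw [add_assoc]; gcongr

variable [BorelSpace X]

theorem relaxedEnergy_sub_le (hf : AEStronglyMeasurable f m) :
    relaxedEnergy m (fun x => f x - g x) ≤ relaxedEnergy m f + relaxedEnergy m g := by
  obtain h1 | h1 := eq_or_ne (relaxedEnergy m f + relaxedEnergy m g) ∞
  · rw [h1]; exact le_top
  rw [ENNReal.add_ne_top] at h1
  refine relaxedEnergy_le fun δ hδ => ?_
  have hδ' : δ / 2 ≠ 0 := (ENNReal.half_pos hδ).ne'
  obtain ⟨u, hu, hud, hue⟩ := exists_energy_le h1.1 hδ'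
  obtain ⟨v, hv, hvd, hve⟩ := exists_energy_le h1.2 hδ'
  have hle : ∀ x, asympLip (fun y => u y - v y) x ≤ asympLip u x + asympLip v x := fun x => by
    simpa [sub_eq_add_neg, asympLip_neg] using asympLip_add_le u (fun y => -v y) x
  refine ⟨fun x => u x - v x, fun x => ne_top_of_le_ne_top (ENNReal.add_ne_top.2 ⟨hu x, hv x⟩)
    (hle x), ?_, ?_⟩
  · calc ∫⁻ x, ‖u x - v x - (f x - g x)‖ₑ ∂m ≤ ∫⁻ x, ‖u x - f x‖ₑ + ‖v x - g x‖ₑ ∂m := by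
          refine lintegral_mono fun x => ?_
          rw [sub_sub_sub_comm]
          exact enorm_sub_le
      _ = ∫⁻ x, ‖u x - f x‖ₑ ∂m + ∫⁻ x, ‖v x - g x‖ₑ ∂m :=
          lintegral_add_left'
            ((continuous_of_asympLip_ne_top hu).aestronglyMeasurable.sub hf).enorm _
      _ ≤ δ := (add_le_add hud hvd).trans (ENNReal.add_halves δ).le
  · calc energy m (fun x => u x - v x) ≤ ∫⁻ x, asympLip u x + asympLip v x ∂m :=
          lintegral_mono hle
      _ = energy m u + energy m v := lintegral_add_left (measurable_asympLip u) _
      _ ≤ _ := add_le_add hue hve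
      _ = _ := by rw [add_add_add_comm, ENNReal.add_halves]

end relaxedEnergy

/-! ### Ramps and the coarea inequality -/

/-- The piecewise linear function that is `0` up to `t - h` and `1` from `t` on. -/
noncomputable def ramp (t h s : ℝ) : ℝ := max 0 (min 1 ((s - (t - h)) / h))

theorem lipschitzWith_ramp (t : ℝ) {h : ℝ} (hh : 0 < h) :
    LipschitzWith (Real.toNNReal h⁻¹) (ramp t h) := by
  refine (LipschitzWith.of_dist_le_mul (f := fun s => (s - (t - h)) / h) fun a b => ?_).const_min 1
    |>.const_max 0
  rw [Real.dist_eq, Real.dist_eq, ← sub_div, abs_div, abs_of_pos hh,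
    Real.coe_toNNReal _ (by positivity), sub_sub_sub_cancel_right, div_eq_inv_mul]

theorem ramp_eq_zero {t h s : ℝ} (hh : 0 < h) (hs : s ≤ t - h) : ramp t h s = 0 :=
  max_eq_left ((min_le_right _ _).trans (div_nonpos_of_nonpos_of_nonneg (by linarith) hh.le))

theorem ramp_eq_one {t h s : ℝ} (hh : 0 < h) (hs : t ≤ s) : ramp t h s = 1 := by
  have : 1 ≤ (s - (t - h)) / h := by rw [le_div_iff₀ hh]; linarith
  rw [ramp, min_eq_left this, max_eq_right zero_le_one]

theorem ramp_mem_Icc (t h s : ℝ) : ramp t h s ∈ Icc (0 : ℝ) 1 :=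
  ⟨le_max_left _ _, max_le zero_le_one (min_le_left _ _)⟩

/-- Dominated convergence: once `h n ≤ t / 2`, the difference lives on `v ≥ t / 2`, where `1 ≤ (2 /
t) * v`. This is why the level must be positive. -/
theorem tendsto_lintegral_ramp_sub_indicator {X : Type*} [MeasurableSpace X] {m : Measure X}
    {v : X → ℝ}    (hvm : Measurable v) (hv : Integrable v m) {t : ℝ}
    (ht : 0 < t) {h : ℕ → ℝ} (hh : ∀ n, 0 < h n) (h0 : Tendsto h atTop (𝓝 0)) :
    Tendsto (fun n => ∫⁻ x, ‖ramp t (h n) (v x) - {x | t ≤ v x}.indicator (fun _ => (1 : ℝ)) x‖ₑ ∂m)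
      atTop (𝓝 0) := by
  have hz : ∀ s : ℝ, ∀ n, s ≤ t - h n ∨ t ≤ s →
      ramp t (h n) s - (if t ≤ s then (1 : ℝ) else 0) = 0 := by
    rintro s n (hs | hs)
    · rw [ramp_eq_zero (hh n) hs, if_neg (by linarith [hh n]), sub_zero]
    · rw [ramp_eq_one (hh n) hs, if_pos hs, sub_self]
  have hi : ∀ x, {x | t ≤ v x}.indicator (fun _ => (1 : ℝ)) x = if t ≤ v x then (1 : ℝ) else 0 :=
    fun x => by simp [indicator]
  simp only [hi]
  have key := tendsto_lintegral_filter_of_dominated_convergence (μ := m) (l := atTop)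
    (F := fun n x => ‖ramp t (h n) (v x) - (if t ≤ v x then (1 : ℝ) else 0)‖ₑ)
    (f := fun _ => 0) (fun x => ENNReal.ofReal (2 / t) * ‖v x‖ₑ)
  simp only [lintegral_zero] at key
  refine key ?_ ?_ ?_ ?_
  · refine Eventually.of_forall fun n => ?_
    have h1 : Measurable fun x => ramp t (h n) (v x) :=
      (lipschitzWith_ramp t (hh n)).continuous.measurable.comp hvm
    have h2 : Measurable fun x => if t ≤ v x then (1 : ℝ) else 0 :=
      Measurable.ite (measurableSet_le measurable_const hvm) measurable_const measurable_const
    exact (h1.sub h2).enorm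
  · filter_upwards [h0.eventually_le_const (half_pos ht)] with n hn
    refine Eventually.of_forall fun x => ?_
    by_cases hx : v x ≤ t - h n ∨ t ≤ v x
    · rw [hz _ _ hx]; simp
    · rw [not_or, not_le, not_le] at hx
      rw [if_neg (not_le.2 hx.2), sub_zero]
      have h1 : ‖ramp t (h n) (v x)‖ₑ ≤ ENNReal.ofReal 1 := by
        rw [Real.enorm_eq_ofReal (ramp_mem_Icc _ _ _).1]
        exact ENNReal.ofReal_le_ofReal (ramp_mem_Icc _ _ _).2
      refine h1.trans ?_
      have hvx : t / 2 ≤ v x := by linarith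
      rw [Real.enorm_eq_ofReal (by linarith), ← ENNReal.ofReal_mul (by positivity)]
      refine ENNReal.ofReal_le_ofReal ?_
      rw [div_mul_eq_mul_div, le_div_iff₀ ht]
      linarith
  · rw [lintegral_const_mul'' _ hv.1.enorm]
    exact ENNReal.mul_ne_top ENNReal.ofReal_ne_top hv.2.ne
  · refine Eventually.of_forall fun x => ?_
    refine tendsto_const_nhds.congr' ?_
    obtain hx | hx := le_or_gt t (v x)
    · exact Eventually.of_forall fun n => by
        simp only [hz _ n (Or.inr hx), enorm_zero]
    · filter_upwards [h0.eventually_le_const (sub_pos.2 hx)] with n hn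
      simp only [hz _ n (Or.inl (show v x ≤ t - h n by linarith)), enorm_zero]

section coarea

variable {X : Type*} [MetricSpace X]

/-- The ramp has slope `h⁻¹`, and its composite with `w` is constant near points where `w` is
outside `[t - h, t]`. The bound is kept as a function of `(t, x)` for Tonelli. -/
theorem asympLip_ramp_comp_le {w : X → ℝ} (hw : ∀ x, asympLip w x ≠ ∞) {t h : ℝ} (hh : 0 < h)
    (x : X) : asympLip (fun y => ramp t h (w y)) x ≤
      {p : ℝ × X | w p.2 ≤ p.1 ∧ p.1 ≤ w p.2 + h}.indicator
        (fun p => ENNReal.ofReal h⁻¹ * asympLip w p.2) (t, x) := by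
  have hc : ContinuousAt w x := continuousAt_of_asympLip_ne_top (hw x)
  by_cases h1 : w x ≤ t ∧ t ≤ w x + h
  · rw [indicator_of_mem (show (t, x) ∈ {p : ℝ × X | w p.2 ≤ p.1 ∧ p.1 ≤ w p.2 + h} from h1)]
    exact asympLip_comp_le (lipschitzWith_ramp t hh) w x (hw x)
  · refine le_trans (le_of_eq ?_) zero_le
    rw [not_and_or, not_le, not_le] at h1
    obtain h1 | h1 := h1
    · refine asympLip_eq_zero_of_eventuallyEq_const (c := 1) ?_
      filter_upwards [continuousAt_const.eventually_lt hc h1] with y hy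
      exact ramp_eq_one hh hy.le
    · refine asympLip_eq_zero_of_eventuallyEq_const (c := 0) ?_
      filter_upwards [hc.eventually_lt continuousAt_const (lt_sub_iff_add_lt.2 h1)] with y hy
      exact ramp_eq_zero hh hy.le

variable [MeasurableSpace X] [BorelSpace X] {m : Measure X}

theorem measurable_indicator_slab {w : X → ℝ} (hw : Continuous w) (h : ℝ) :
    Measurable ({p : ℝ × X | w p.2 ≤ p.1 ∧ p.1 ≤ w p.2 + h}.indicator
      (fun p => ENNReal.ofReal h⁻¹ * asympLip w p.2)) := by
  have hw2 : Measurable fun p : ℝ × X => w p.2 := hw.measurable.comp measurable_snd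
  refine Measurable.indicator (((measurable_asympLip w).comp measurable_snd).const_mul _) ?_
  exact (measurableSet_le hw2 measurable_fst).inter
    (measurableSet_le measurable_fst (hw2.add_const h))

/-- For fixed `x` the levels `t` in the slab form an interval of length `h`, which cancels the slope
`h⁻¹`. -/
theorem lintegral_lintegral_indicator_eq_energy [SFinite m] {w : X → ℝ} (hw : Continuous w)
    {h : ℝ} (hh : 0 < h) :
    ∫⁻ t, ∫⁻ x, {p : ℝ × X | w p.2 ≤ p.1 ∧ p.1 ≤ w p.2 + h}.indicator
        (fun p => ENNReal.ofReal h⁻¹ * asympLip w p.2) (t, x) ∂m = energy m w := by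
  refine (lintegral_lintegral_swap (μ := volume) (ν := m) (f := fun t x =>
    {p : ℝ × X | w p.2 ≤ p.1 ∧ p.1 ≤ w p.2 + h}.indicator
      (fun p => ENNReal.ofReal h⁻¹ * asympLip w p.2) (t, x))
    (measurable_indicator_slab hw h).aemeasurable).trans ?_
  refine lintegral_congr fun x => ?_
  have : ∀ t, {p : ℝ × X | w p.2 ≤ p.1 ∧ p.1 ≤ w p.2 + h}.indicator
      (fun p => ENNReal.ofReal h⁻¹ * asympLip w p.2) (t, x) =
      (Icc (w x) (w x + h)).indicator (fun _ => ENNReal.ofReal h⁻¹ * asympLip w x) t := fun _ => rfl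
  simp only [this]
  rw [lintegral_indicator_const measurableSet_Icc, Real.volume_Icc, add_sub_cancel_left,
    mul_right_comm, ← ENNReal.ofReal_mul (by positivity), inv_mul_cancel₀ hh.ne',
    ENNReal.ofReal_one, one_mul]

/-- A coarea inequality: if `w n → v` in `L¹` fast enough, then the relaxed energies of the
superlevel sets of `v` are bounded, in an integrated sense, by the energies of `w n`. -/
theorem exists_lintegral_le_liminf_energy [SFinite m] {w : ℕ → X → ℝ} {v : X → ℝ}
    (hw : ∀ n x, asympLip (w n) x ≠ ∞) (hvm : Measurable v) (hv : Integrable v m)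
    (hd : ∀ n, ∫⁻ x, ‖w n x - v x‖ₑ ∂m ≤ (((n : ℝ≥0∞) + 1) ^ 2)⁻¹) :
    ∃ p : ℝ → ℝ≥0∞, Measurable p ∧ ∫⁻ t, p t ≤ liminf (fun n => energy m (w n)) atTop ∧
      ∀ t > 0, relaxedEnergy m ({x | t ≤ v x}.indicator fun _ => 1) ≤ p t := by
  -- The ramp multiplies the L¹ error `(n + 1)⁻²` by its slope `n + 1`, and the product still tends
  -- to zero.
  set h : ℕ → ℝ := fun n => ((n : ℝ) + 1)⁻¹ with hdef
  have hh : ∀ n, 0 < h n := fun n => by positivity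
  have h0 : Tendsto h atTop (𝓝 0) := by simpa using tendsto_one_div_add_atTop_nhds_zero_nat (𝕜 := ℝ)
  have hc : ∀ n, Continuous (w n) := fun n => continuous_of_asympLip_ne_top (hw n)
  set g : ℕ → ℝ → ℝ≥0∞ := fun n t => ∫⁻ x,
      {p : ℝ × X | w n p.2 ≤ p.1 ∧ p.1 ≤ w n p.2 + h n}.indicator
        (fun p => ENNReal.ofReal (h n)⁻¹ * asympLip (w n) p.2) (t, x) ∂m with hg
  have hgm : ∀ n, Measurable (g n) := fun n =>
    (measurable_indicator_slab (hc n) (h n)).lintegral_prod_right'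
  refine ⟨fun t => liminf (fun n => g n t) atTop, Measurable.liminf hgm, ?_, fun t ht => ?_⟩
  · refine (lintegral_liminf_le hgm).trans (le_of_eq ?_)
    congr 1
    ext n
    exact lintegral_lintegral_indicator_eq_energy (hc n) (hh n)
  · have hfin : ∀ n x, asympLip (fun y => ramp t (h n) (w n y)) x ≠ ∞ := fun n x =>
      ne_top_of_le_ne_top (ENNReal.mul_ne_top ENNReal.coe_ne_top (hw n x))
        (asympLip_comp_le (lipschitzWith_ramp t (hh n)) (w n) x (hw n x))
    refine (relaxedEnergy_le_liminf hfin ?_).trans (liminf_le_liminf (Eventually.of_forall fun n =>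
      lintegral_mono fun x => asympLip_ramp_comp_le (hw n) (hh n) x))
    have hr : ∀ n, Continuous (ramp t (h n)) := fun n => (lipschitzWith_ramp t (hh n)).continuous
    have hle : ∀ n, ∫⁻ x, ‖ramp t (h n) (w n x) - {x | t ≤ v x}.indicator (fun _ => (1 : ℝ)) x‖ₑ ∂m
        ≤ ((n : ℝ≥0∞) + 1)⁻¹ + ∫⁻ x, ‖ramp t (h n) (v x) -
          {x | t ≤ v x}.indicator (fun _ => (1 : ℝ)) x‖ₑ ∂m := by
      intro n
      refine (lintegral_enorm_sub_le (g := fun x => ramp t (h n) (v x))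
        ((hr n).comp_aestronglyMeasurable hv.1) ?_).trans ?_
      · exact (measurable_const.indicator
          (measurableSet_le measurable_const hvm)).aestronglyMeasurable
      · gcongr
        calc ∫⁻ x, ‖ramp t (h n) (w n x) - ramp t (h n) (v x)‖ₑ ∂m
            ≤ ∫⁻ x, ((n : ℝ≥0∞) + 1) * ‖w n x - v x‖ₑ ∂m := by
              refine lintegral_mono fun x => ?_
              have := (lipschitzWith_ramp t (hh n)).edist_le_mul (w n x) (v x)
              rw [edist_eq_enorm_sub, edist_eq_enorm_sub] at this
              refine this.trans (le_of_eq ?_)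
              congr 1
              simp only [hdef, inv_inv]
              rw [← ENNReal.ofReal, ENNReal.ofReal_add (by positivity) zero_le_one]
              simp
          _ = ((n : ℝ≥0∞) + 1) * ∫⁻ x, ‖w n x - v x‖ₑ ∂m :=
              lintegral_const_mul'' _ ((hc n).aestronglyMeasurable.sub hv.1).enorm
          _ ≤ ((n : ℝ≥0∞) + 1) * (((n : ℝ≥0∞) + 1) ^ 2)⁻¹ := by gcongr; exact hd n
          _ ≤ ((n : ℝ≥0∞) + 1)⁻¹ := by
              rw [sq, ENNReal.mul_inv (by simp) (by simp), ← mul_assoc,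
                ENNReal.mul_inv_cancel (by simp) (by finiteness), one_mul]
    refine tendsto_of_tendsto_of_tendsto_of_le_of_le tendsto_const_nhds ?_ (fun _ => zero_le) hle
    have h1 : Tendsto (fun n : ℕ => ((n : ℝ≥0∞) + 1)⁻¹) atTop (𝓝 0) := by
      simpa using (tendsto_add_atTop_iff_nat 1).2 ENNReal.tendsto_inv_nat_nhds_zero
    simpa using h1.add (tendsto_lintegral_ramp_sub_indicator hvm hv ht hh h0)

end coarea

/-! ### Dyadic gluing and approximation in weighted L¹ -/

section gluing

variable {X : Type*} [MetricSpace X]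

/-- Every function `g` is dominated by `2 / r` for a `1`-Lipschitz function `r` that is positive
at all points near which `g` is bounded. -/
theorem exists_lipschitzWith_le_div (g : X → ℝ≥0∞) : ∃ r : X → ℝ, LipschitzWith 1 r ∧
    (∀ x, 0 ≤ r x) ∧ (∀ x, r x ≤ 1) ∧ (∀ x, 0 < r x → g x ≤ ENNReal.ofReal (2 / r x)) ∧
    ∀ x, (∃ C : ℝ≥0, ∀ᶠ y in 𝓝 x, g y ≤ C) → 0 < r x := by
  -- `r x` is the supremum of the radii `s ≤ 1` with `g ≤ 1 / s` on the ball of radius `s`. Moving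
  -- the centre by `d` shrinks an admissible radius by at most `d`.
  set S : X → Set ℝ := fun x =>
    {s | 0 ≤ s ∧ s ≤ 1 ∧ ∀ y ∈ Metric.ball x s, ENNReal.ofReal s * g y ≤ 1} with hS
  have h0 : ∀ x, (0 : ℝ) ∈ S x := fun x => ⟨le_rfl, zero_le_one, by simp⟩
  have hb : ∀ x, BddAbove (S x) := fun x => ⟨1, fun s hs => hs.2.1⟩
  have hr0 : ∀ x, 0 ≤ sSup (S x) := fun x => le_csSup (hb x) (h0 x)
  refine ⟨fun x => sSup (S x), LipschitzWith.of_le_add fun x y => ?_, hr0,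
    fun x => csSup_le ⟨0, h0 x⟩ fun s hs => hs.2.1, fun x hx => ?_, fun x hx => ?_⟩
  · refine csSup_le ⟨0, h0 x⟩ fun s hs => ?_
    obtain h | h := le_or_gt s (dist x y)
    · exact h.trans (le_add_of_nonneg_left (hr0 y))
    · rw [← sub_le_iff_le_add]
      refine le_csSup (hb y) ⟨by linarith, by linarith [hs.2.1, dist_nonneg (x := x) (y := y)],
        fun z hz => ?_⟩
      refine le_trans ?_ (hs.2.2 z ?_)
      · gcongr
        linarith [dist_nonneg (x := x) (y := y)]
      · rw [Metric.mem_ball] at hz ⊢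
        linarith [dist_triangle z y x, dist_comm x y]
  -- The supremum may not be attained; a radius above `r x / 2` costs the factor 2.
  · obtain ⟨s, hs, hlt⟩ := exists_lt_of_lt_csSup ⟨0, h0 x⟩ (half_lt_self hx)
    have hs0 : 0 < s := (half_pos hx).trans hlt
    have h1 := hs.2.2 x (Metric.mem_ball_self hs0)
    calc g x ≤ ENNReal.ofReal s⁻¹ := by
          rw [ENNReal.ofReal_inv_of_pos hs0]
          exact ENNReal.le_inv_iff_mul_le.2 (by rwa [mul_comm])
      _ ≤ _ := by
          refine ENNReal.ofReal_le_ofReal ?_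
          rw [← inv_div]
          exact inv_anti₀ (half_pos hx) hlt.le
  · obtain ⟨C, hC⟩ := hx
    obtain ⟨ε, hε, hC⟩ := Metric.eventually_nhds_iff_ball.1 hC
    have hpos : (0 : ℝ) < min (min 1 ε) ((C : ℝ) + 1)⁻¹ := by positivity
    refine hpos.trans_le (le_csSup (hb x) ⟨hpos.le, (min_le_left _ _).trans (min_le_left _ _),
      fun y hy => ?_⟩)
    have hy' : y ∈ Metric.ball x ε :=
      Metric.ball_subset_ball ((min_le_left _ _).trans (min_le_right _ _)) hy
    calc ENNReal.ofReal (min (min 1 ε) ((C : ℝ) + 1)⁻¹) * g y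
        ≤ ENNReal.ofReal ((C : ℝ) + 1)⁻¹ * ENNReal.ofReal C := by
          gcongr
          · exact min_le_right _ _
          · simpa using hC y hy'
      _ ≤ 1 := by
          rw [← ENNReal.ofReal_mul (by positivity), ← ENNReal.ofReal_one]
          refine ENNReal.ofReal_le_ofReal ?_
          rw [inv_mul_le_iff₀ (by positivity)]
          linarith

/-- The cutoff to the `k`-th dyadic layer `2 ^ (-k - 1) < s < 2 ^ (1 - k)`. -/
noncomputable def layer (k : ℕ) (s : ℝ) : ℝ :=
  ramp (2 * (1 / 2) ^ (k + 1)) ((1 / 2) ^ (k + 1)) s - ramp (2 * (1 / 2) ^ k) ((1 / 2) ^ k) s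

theorem layer_mem_Icc (k : ℕ) (s : ℝ) : layer k s ∈ Icc (0 : ℝ) 1 := by
  have h1 := ramp_mem_Icc (2 * (1 / 2) ^ (k + 1)) ((1 / 2) ^ (k + 1)) s
  have h2 := ramp_mem_Icc (2 * (1 / 2) ^ k) ((1 / 2) ^ k) s
  rw [layer]
  obtain h | h := le_total s ((1 / 2) ^ k)
  · rw [ramp_eq_zero (t := 2 * (1 / 2) ^ k) (by positivity) (by linarith), sub_zero]
    exact h1
  · rw [ramp_eq_one (t := 2 * (1 / 2) ^ (k + 1)) (by positivity) (by rw [pow_succ]; linarith)]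
    exact ⟨by linarith [h2.2], by linarith [h2.1]⟩

theorem layer_eq_zero_of_le {k : ℕ} {s : ℝ} (h : s ≤ (1 / 2) ^ (k + 1)) : layer k s = 0 := by
  have h2 : ((1 : ℝ) / 2) ^ (k + 1) ≤ (1 / 2) ^ k := by
    rw [pow_succ]; linarith [show (0 : ℝ) < (1 / 2) ^ k by positivity]
  rw [layer, ramp_eq_zero (by positivity) (by linarith),
    ramp_eq_zero (by positivity) (by linarith), sub_zero]

theorem layer_eq_zero_of_ge {k : ℕ} {s : ℝ} (h : 2 * (1 / 2) ^ k ≤ s) : layer k s = 0 := by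
  rw [layer, ramp_eq_one (by positivity) (by
    rw [pow_succ]; linarith [show (0 : ℝ) < (1 / 2) ^ k by positivity]),
    ramp_eq_one (by positivity) h, sub_self]

/-- The sum telescopes to the last ramp, which is 1, minus the zeroth, which vanishes on `s ≤ 1`. -/
theorem sum_layer {N : ℕ} {s : ℝ} (h1 : s ≤ 1) (h : 2 * (1 / 2) ^ N ≤ s) :
    ∑ k ∈ Finset.range N, layer k s = 1 := by
  simp only [layer]
  rw [Finset.sum_range_sub (fun k => ramp (2 * (1 / 2) ^ k) ((1 / 2) ^ k) s),
    ramp_eq_one (by positivity) h, ramp_eq_zero (by norm_num) (by norm_num; exact h1), sub_zero]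

theorem sum_layer_le_one (N : ℕ) (s : ℝ) : ∑ k ∈ Finset.range N, layer k s ≤ 1 := by
  simp only [layer]
  rw [Finset.sum_range_sub (fun k => ramp (2 * (1 / 2) ^ k) ((1 / 2) ^ k) s)]
  linarith [(ramp_mem_Icc (2 * (1 / 2) ^ N) ((1 / 2) ^ N) s).2,
    (ramp_mem_Icc (2 * (1 / 2) ^ 0) ((1 / 2) ^ 0) s).1]

theorem lipschitzWith_layer (k : ℕ) : LipschitzWith (2 ^ (k + 2)) (layer k) := by
  have h1 := (lipschitzWith_ramp (2 * (1 / 2) ^ (k + 1))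
    (show (0 : ℝ) < (1 / 2) ^ (k + 1) by positivity)).sub
    (lipschitzWith_ramp (2 * (1 / 2) ^ k) (show (0 : ℝ) < (1 / 2) ^ k by positivity))
  refine h1.weaken ?_
  have : ∀ j : ℕ, Real.toNNReal (((1 : ℝ) / 2) ^ j)⁻¹ = 2 ^ j := fun j => by
    rw [← NNReal.coe_inj, Real.coe_toNNReal _ (by positivity)]; simp
  rw [this, this]
  have h2 : (0 : ℝ≥0) ≤ 2 ^ k := zero_le
  calc (2 : ℝ≥0) ^ (k + 1) + 2 ^ k ≤ 2 ^ (k + 1) + 2 ^ (k + 1) := by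
        gcongr
        · norm_num
        · omega
    _ = 2 ^ (k + 2) := by ring

/-- By compactness of `ℝ≥0∞`, one ultrafilter gives limits for all `k` at once, and finite sums pass
to the limit. It allows a different index `n` for each layer `k` while the total energy stays near
`W`. -/
theorem exists_tsum_le_of_sum_le {b : ℕ → ℕ → ℝ≥0∞} {e : ℕ → ℝ≥0∞} {W : ℝ≥0∞}
    (h : ∀ n N, ∑ k ∈ Finset.range N, b n k ≤ e n) (he : Tendsto e atTop (𝓝 W)) :
    ∃ a : ℕ → ℝ≥0∞, ∑' k, a k ≤ W ∧ ∀ k, ∀ c > a k, ∃ᶠ n in atTop, b n k < c := by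
  set U := hyperfilter ℕ
  have hU : (U : Filter ℕ) ≤ atTop := Nat.hyperfilter_le_atTop
  have hlim : ∀ k, ∃ a, Tendsto (fun n => b n k) U (𝓝 a) := fun k =>
    ⟨(U.map fun n => b n k).lim, (U.map fun n => b n k).le_nhds_lim⟩
  choose a ha using hlim
  refine ⟨a, ENNReal.tsum_le_of_sum_range_le fun N => ?_, fun k c hc => ?_⟩
  · exact le_of_tendsto_of_tendsto' (tendsto_finsetSum _ fun k _ => ha k) (he.mono_left hU)
      fun n => h n N
  · exact ((ha k).eventually_lt_const hc).frequently.filter_mono hU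

end gluing

section glue

variable {X : Type*} {r : X → ℝ}

/-- The function that agrees with `ρ k` on the `k`-th dyadic layer of `r`, up to interpolation. -/
noncomputable def glue (r : X → ℝ) (ρ : ℕ → X → ℝ) (x : X) : ℝ := ∑' k, layer k (r x) * ρ k x

theorem glue_eq_sum {ρ : ℕ → X → ℝ} {x : X} {N : ℕ} (hN : ∀ k ≥ N, 2 * (1 / 2) ^ k ≤ r x) :
    glue r ρ x = ∑ k ∈ Finset.range N, layer k (r x) * ρ k x :=
  tsum_eq_sum fun k hk => by
    rw [layer_eq_zero_of_ge (hN k (by simpa using hk)), zero_mul]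

theorem glue_eq_add_sum {ρ : ℕ → X → ℝ} {x : X} {N : ℕ} (h1 : r x ≤ 1)
    (hN : ∀ k ≥ N, 2 * (1 / 2) ^ k ≤ r x) (c : ℝ) :
    glue r ρ x = c + ∑ k ∈ Finset.range N, layer k (r x) * (ρ k x - c) := by
  simp only [mul_sub, Finset.sum_sub_distrib, ← Finset.sum_mul, sum_layer h1 (hN N le_rfl),
    glue_eq_sum hN]
  ring

end glue

section gluing

variable {X : Type*} [MetricSpace X] {f r : X → ℝ}

theorem asympLip_sub_const (u : X → ℝ) (c : ℝ) (x : X) :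
    asympLip (fun y => u y - c) x = asympLip u x :=
  le_antisymm (asympLip_mono_of_eventually <| Eventually.of_forall fun p => by simp)
    (asympLip_mono_of_eventually <| Eventually.of_forall fun p => by simp)

theorem exists_eventually_dyadic_lt (hr : Continuous r) {x : X} (hx : 0 < r x) :
    ∃ N : ℕ, ∀ᶠ y in 𝓝 x, ∀ k ≥ N, 2 * (1 / 2) ^ k ≤ r y := by
  obtain ⟨N, hN⟩ := exists_pow_lt_of_lt_one (half_pos hx) (show (1 : ℝ) / 2 < 1 by norm_num)
  refine ⟨N, ?_⟩
  filter_upwards [(hr.tendsto x).eventually_const_lt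
    (show 2 * (1 / 2) ^ N < r x by linarith)] with y hy k hk
  refine le_trans ?_ hy.le
  gcongr 2 * ?_
  exact pow_le_pow_of_le_one (by norm_num) (by norm_num) hk

/-- As the layers sum to 1 near `x`, subtracting a constant `c` from every `ρ k` changes the glued
function only by `c`. The slopes of the layers therefore multiply `ρ k - c`, which is small for `c =
f x`. -/
theorem asympLip_glue_le {ρ : ℕ → X → ℝ} (hr : LipschitzWith 1 r) (hr1 : ∀ x, r x ≤ 1) {x : X}
    (hx : 0 < r x) (hρ : ∀ k x, asympLip (ρ k) x ≠ ∞) (c : ℝ) : ∃ N : ℕ,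
    asympLip (glue r ρ) x ≤ ∑ k ∈ Finset.range N,
      (‖layer k (r x)‖ₑ * asympLip (ρ k) x + 2 ^ (k + 2) * ‖ρ k x - c‖ₑ) := by
  obtain ⟨N, hN⟩ := exists_eventually_dyadic_lt hr.continuous hx
  refine ⟨N, ?_⟩
  have h1 : glue r ρ =ᶠ[𝓝 x] fun y =>
      (∑ k ∈ Finset.range N, layer k (r y) * (ρ k y - c)) - (-c) := by
    filter_upwards [hN] with y hy
    rw [glue_eq_add_sum (hr1 y) hy c]; ring
  rw [asympLip_congr h1, asympLip_sub_const]
  refine (asympLip_sum_le _ (fun k y => layer k (r y) * (ρ k y - c)) _).trans ?_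
  refine Finset.sum_le_sum fun k _ => ?_
  have h2 : asympLip (fun y => layer k (r y)) x ≤ 2 ^ (k + 2) := by
    simpa [Function.comp_def] using asympLip_le_of_lipschitzWith ((lipschitzWith_layer k).comp hr) x
  refine (asympLip_mul_le (u := fun y => layer k (r y)) (v := fun y => ρ k y - c)
    (ne_top_of_le_ne_top (by finiteness) h2) (by rw [asympLip_sub_const]; exact hρ k x)).trans ?_
  rw [asympLip_sub_const, mul_comm (‖ρ k x - c‖ₑ)]
  gcongr

/-- Where layer `k` is nonzero, `r x > 2 ^ (-k - 1)`, so `g x ≤ 2 ^ (k + 2)` and the weight is at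
most `2 ^ (k + 3)`. -/
theorem weight_mul_enorm_glue_sub_le {ρ : ℕ → X → ℝ} {g : X → ℝ≥0∞} (hr : Continuous r)
    (hr1 : ∀ x, r x ≤ 1) {x : X} (hx : 0 < r x) (hg : g x ≤ ENNReal.ofReal (2 / r x)) (c : ℝ) :
    ∃ N : ℕ, (1 + g x) * ‖glue r ρ x - c‖ₑ ≤
      ∑ k ∈ Finset.range N, 2 ^ (k + 3) * ‖ρ k x - c‖ₑ := by
  obtain ⟨N, hN⟩ := exists_eventually_dyadic_lt hr hx
  refine ⟨N, ?_⟩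
  rw [glue_eq_add_sum (hr1 x) hN.self_of_nhds c, add_sub_cancel_left]
  refine (mul_le_mul_right (enorm_sum_le _ _) _).trans ?_
  rw [Finset.mul_sum]
  refine Finset.sum_le_sum fun k _ => ?_
  rw [enorm_mul, ← mul_assoc]
  gcongr
  obtain h | h := le_or_gt (r x) ((1 / 2) ^ (k + 1))
  · simp [layer_eq_zero_of_le h]
  have h3 : ‖layer k (r x)‖ₑ ≤ 1 := by
    rw [Real.enorm_eq_ofReal (layer_mem_Icc _ _).1, ← ENNReal.ofReal_one]
    exact ENNReal.ofReal_le_ofReal (layer_mem_Icc _ _).2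
  have h4 : g x ≤ 2 ^ (k + 2) := by
    refine hg.trans ?_
    have : (2 : ℝ≥0∞) ^ (k + 2) = ENNReal.ofReal (2 ^ (k + 2)) := by
      rw [ENNReal.ofReal_pow (by norm_num)]; simp
    rw [this]
    refine ENNReal.ofReal_le_ofReal ?_
    rw [div_le_iff₀ hx]
    have e : (2 : ℝ) ^ (k + 2) * (1 / 2) ^ (k + 1) = 2 := by
      rw [pow_succ 2 (k + 1), one_div, inv_pow]; field_simp
    nlinarith [mul_le_mul_of_nonneg_left h.le (show (0 : ℝ) ≤ 2 ^ (k + 2) by positivity)]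
  calc (1 + g x) * ‖layer k (r x)‖ₑ ≤ (2 ^ (k + 2) + 2 ^ (k + 2)) * 1 := by
        gcongr
        exact one_le_pow₀ (by norm_num)
    _ = 2 ^ (k + 3) := by ring

variable [MeasurableSpace X] [BorelSpace X] {m : Measure X}

/-- The approximating functions in the definition of the relaxed energy may be chosen so as to
converge in a weighted `L¹` space, for any locally bounded weight. -/
theorem exists_energy_le_weighted (hf : Measurable f) (hW : relaxedEnergy m f ≠ ∞) {g : X → ℝ≥0∞}
    (hg : ∀ x, ∃ C : ℝ≥0, ∀ᶠ y in 𝓝 x, g y ≤ C) {δ : ℝ≥0∞} (hδ : δ ≠ 0) :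
    ∃ ρ : X → ℝ, (∀ x, asympLip ρ x ≠ ∞) ∧ ∫⁻ x, (1 + g x) * ‖ρ x - f x‖ₑ ∂m ≤ δ ∧
      energy m ρ ≤ relaxedEnergy m f + δ := by
  obtain ⟨r, hr, -, hr1, hgr, hpos⟩ := exists_lipschitzWith_le_div g
  have hpos : ∀ x, 0 < r x := fun x => hpos x (hg x)
  have hinv : ∀ n : ℕ, (n + 1 : ℝ≥0∞)⁻¹ ≠ 0 := fun n => by simp
  choose v hv hvd hve using fun n => exists_energy_le hW (hinv n)
  have ht : Tendsto (fun n : ℕ => (n + 1 : ℝ≥0∞)⁻¹) atTop (𝓝 0) := by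
    simpa using (tendsto_add_atTop_iff_nat 1).2 ENNReal.tendsto_inv_nat_nhds_zero
  have hlm : ∀ k, Measurable fun x => ‖layer k (r x)‖ₑ := fun k =>
    ((lipschitzWith_layer k).continuous.comp hr.continuous).measurable.enorm
  have hlam : ∀ k u, Measurable fun x => ‖layer k (r x)‖ₑ * asympLip u x := fun k u =>
    (hlm k).mul (measurable_asympLip u)
  have hsum : ∀ n N, ∑ k ∈ Finset.range N, ∫⁻ x, ‖layer k (r x)‖ₑ * asympLip (v n) x ∂m ≤
      relaxedEnergy m f + (n + 1 : ℝ≥0∞)⁻¹ := by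
    intro n N
    refine le_trans ?_ (hve n)
    rw [← lintegral_finsetSum _ fun k _ => hlam k _]
    refine lintegral_mono fun x => ?_
    rw [← Finset.sum_mul]
    refine mul_le_of_le_one_left zero_le ?_
    rw [Finset.sum_congr rfl fun k _ => Real.enorm_eq_ofReal (layer_mem_Icc k (r x)).1,
      ← ENNReal.ofReal_sum_of_nonneg fun k _ => (layer_mem_Icc k (r x)).1, ← ENNReal.ofReal_one]
    exact ENNReal.ofReal_le_ofReal (sum_layer_le_one N (r x))
  obtain ⟨a, haW, ha⟩ := exists_tsum_le_of_sum_le hsum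
    (by simpa using tendsto_const_nhds.add ht)
  obtain ⟨ε, hε, hεδ⟩ := ENNReal.exists_pos_sum_of_countable hδ ℕ
  have hak : ∀ k, a k ≠ ∞ := fun k => ne_top_of_le_ne_top hW ((ENNReal.le_tsum k).trans haW)
  -- The divisor `2 ^ (k + 3)` absorbs both the weight on layer `k` and the factor `1 + 2 ^ (k + 2)`
  -- arising in the energy estimate.
  have hchoice : ∀ k : ℕ, ∃ n, ∫⁻ x, ‖layer k (r x)‖ₑ * asympLip (v n) x ∂m ≤
      a k + (ε k : ℝ≥0∞) / 2 ^ (k + 3) ∧ ∫⁻ x, ‖v n x - f x‖ₑ ∂m ≤ (ε k : ℝ≥0∞) / 2 ^ (k + 3) := by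
    intro k
    have h0 : (ε k : ℝ≥0∞) / 2 ^ (k + 3) ≠ 0 :=
      ENNReal.div_ne_zero.2 ⟨by exact_mod_cast (hε k).ne', by finiteness⟩
    obtain ⟨n, h1, h2⟩ := ((ha k _ (ENNReal.lt_add_right (hak k) h0)).and_eventually
      (ht.eventually_le_const h0.bot_lt)).exists
    exact ⟨n, h1.le, (hvd n).trans h2⟩
  choose n hn1 hn2 using hchoice
  set ρ : ℕ → X → ℝ := fun k => v (n k) with hρ
  have hρm : ∀ k, Measurable fun x => ‖ρ k x - f x‖ₑ := fun k =>
    ((continuous_of_asympLip_ne_top (hv (n k))).measurable.sub hf).enorm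
  refine ⟨glue r ρ, fun x => ?_, ?_, ?_⟩
  · obtain ⟨N, hN⟩ := asympLip_glue_le hr hr1 (hpos x) (fun k => hv (n k)) 0
    refine ne_top_of_le_ne_top (ENNReal.sum_ne_top.2 fun k _ => ?_) hN
    exact ENNReal.add_ne_top.2 ⟨ENNReal.mul_ne_top enorm_ne_top (hv _ _), by finiteness⟩
  · calc ∫⁻ x, (1 + g x) * ‖glue r ρ x - f x‖ₑ ∂m
        ≤ ∫⁻ x, ∑' k : ℕ, 2 ^ (k + 3) * ‖ρ k x - f x‖ₑ ∂m := by
          refine lintegral_mono fun x => ?_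
          obtain ⟨N, hN⟩ := weight_mul_enorm_glue_sub_le (ρ := ρ) hr.continuous hr1 (hpos x)
            (hgr x (hpos x)) (f x)
          exact hN.trans (ENNReal.sum_le_tsum _)
      _ = ∑' k : ℕ, 2 ^ (k + 3) * ∫⁻ x, ‖ρ k x - f x‖ₑ ∂m := by
          rw [lintegral_tsum fun k => ((hρm k).const_mul _).aemeasurable]
          exact tsum_congr fun k => lintegral_const_mul _ (hρm k)
      _ ≤ ∑' k, (ε k : ℝ≥0∞) := by
          refine ENNReal.tsum_le_tsum fun k => ?_
          refine (mul_le_mul_right (hn2 k) _).trans ?_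
          rw [ENNReal.mul_div_cancel (by simp) (by finiteness)]
      _ ≤ δ := hεδ.le
  · calc energy m (glue r ρ)
        ≤ ∫⁻ x, ∑' k : ℕ, (‖layer k (r x)‖ₑ * asympLip (ρ k) x
            + 2 ^ (k + 2) * ‖ρ k x - f x‖ₑ) ∂m := by
          refine lintegral_mono fun x => ?_
          obtain ⟨N, hN⟩ := asympLip_glue_le hr hr1 (hpos x) (fun k => hv (n k)) (f x)
          exact hN.trans (ENNReal.sum_le_tsum _)
      _ = ∑' k : ℕ, (∫⁻ x, ‖layer k (r x)‖ₑ * asympLip (ρ k) x ∂m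
            + 2 ^ (k + 2) * ∫⁻ x, ‖ρ k x - f x‖ₑ ∂m) := by
          refine (lintegral_tsum fun k => ((hlam k (ρ k)).add
            ((hρm k).const_mul _)).aemeasurable).trans (tsum_congr fun k => ?_)
          exact (lintegral_add_left (hlam k (ρ k)) _).trans
            (by rw [lintegral_const_mul _ (hρm k)])
      _ ≤ ∑' k, (a k + ε k) := by
          refine ENNReal.tsum_le_tsum fun k => ?_
          calc _ ≤ (a k + (ε k : ℝ≥0∞) / 2 ^ (k + 3)) +
                2 ^ (k + 2) * ((ε k : ℝ≥0∞) / 2 ^ (k + 3)) :=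
              add_le_add (hn1 k) (mul_le_mul_right (hn2 k) _)
            _ = a k + (1 + 2 ^ (k + 2)) * ((ε k : ℝ≥0∞) / 2 ^ (k + 3)) := by ring
            _ ≤ a k + 2 ^ (k + 3) * ((ε k : ℝ≥0∞) / 2 ^ (k + 3)) := by
              gcongr
              calc (1 : ℝ≥0∞) + 2 ^ (k + 2) ≤ 2 ^ (k + 2) + 2 ^ (k + 2) := by
                    gcongr
                    exact one_le_pow₀ (by norm_num)
                _ = 2 ^ (k + 3) := by ring
            _ = _ := by rw [ENNReal.mul_div_cancel (by simp) (by finiteness)]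
      _ = ∑' k, a k + ∑' k, (ε k : ℝ≥0∞) := ENNReal.tsum_add
      _ ≤ _ := add_le_add haW hεδ.le

end gluing

/-! ### Sets of finite perimeter and penalized minimizers -/

theorem lintegral_enorm_indicator_sub {X : Type*} [MeasurableSpace X] {m : Measure X} {E F : Set X}
    (hF : MeasurableSet F) (hE : MeasurableSet E)
    (h : F ⊆ E) :
    ∫⁻ x, ‖E.indicator (fun _ => (1 : ℝ)) x - F.indicator (fun _ => (1 : ℝ)) x‖ₑ ∂m =
      m (E \ F) := by
  rw [← lintegral_indicator_one (hE.diff hF)]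
  refine lintegral_congr fun x => ?_
  by_cases h1 : x ∈ F
  · simp [h1, h h1]
  · by_cases h2 : x ∈ E <;> simp [h1, h2]

section minimizer

variable {X : Type*} [MetricSpace X] [MeasurableSpace X] {m : Measure X}

/-- The perimeter of a set, as the relaxed energy of its characteristic function. -/
noncomputable def perimeter (m : Measure X) (E : Set X) : ℝ≥0∞ :=
  relaxedEnergy m (E.indicator fun _ => 1)

theorem perimeter_iInter_le {G : ℕ → Set X} (hG : Antitone G) (hGm : ∀ k, MeasurableSet (G k))
    (hfin : m (G 0) ≠ ∞) {c : ℝ≥0∞} (h : ∀ᶠ k in atTop, perimeter m (G k) ≤ c) :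
    perimeter m (⋂ k, G k) ≤ c := by
  have hm : MeasurableSet (⋂ k, G k) := MeasurableSet.iInter hGm
  have ht : Tendsto (fun k => m (G k \ ⋂ k, G k)) atTop (𝓝 0) := by
    have := tendsto_measure_iInter_atTop (μ := m) (s := fun k => G k \ ⋂ k, G k)
      (fun k => ((hGm k).diff hm).nullMeasurableSet)
      (fun i j hij => sdiff_subset_sdiff_left (hG hij))
      ⟨0, measure_ne_top_of_subset sdiff_subset hfin⟩
    have he : ⋂ k, G k \ ⋂ k, G k = ∅ := by
      ext x
      simp only [mem_iInter, Set.mem_sdiff, mem_empty_iff_false, iff_false]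
      exact fun h => (h 0).2 fun k => (h k).1
    rwa [he, measure_empty] at this
  refine relaxedEnergy_le_of_approx (measurable_const.indicator hm).aestronglyMeasurable
    fun δ hδ => ?_
  obtain ⟨k, hk, hk'⟩ := (h.and (ht.eventually_le_const hδ.bot_lt)).exists
  refine ⟨(G k).indicator fun _ => 1, (measurable_const.indicator (hGm k)).aestronglyMeasurable,
    ?_, hk.trans le_self_add⟩
  rwa [lintegral_enorm_indicator_sub hm (hGm k) (iInter_subset _ _)]

variable [BorelSpace X]

/-- Below every closed set of finite perimeter there is a closed set that minimizes the sum of the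
perimeter and a multiple of the removed measure among its own closed subsets. -/
theorem exists_isClosed_minimizer {G₀ : Set X} (h₀ : IsClosed G₀) (hm : m G₀ ≠ ∞)
    (hP : perimeter m G₀ ≠ ∞) (c : ℝ≥0) : ∃ G ⊆ G₀, IsClosed G ∧
    perimeter m G + c * m (G₀ \ G) ≤ perimeter m G₀ ∧
    ∀ G' ⊆ G, IsClosed G' → perimeter m G ≤ perimeter m G' + c * m (G \ G') := by
  -- An Ekeland-type argument: `G' ∈ S G` is a transitive relation along which the perimeter drops
  -- by at least `c` times the removed measure.
  set S : Set X → Set (Set X) := fun G =>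
    {G' | G' ⊆ G ∧ IsClosed G' ∧ perimeter m G' + c * m (G \ G') ≤ perimeter m G} with hS
  have hSself : ∀ {G}, IsClosed G → G ∈ S G := fun hG => ⟨Subset.rfl, hG, by simp⟩
  have hStrans : ∀ {G G' G''}, G' ∈ S G → G'' ∈ S G' → G'' ∈ S G := by
    rintro G G' G'' ⟨h1, h2, h3⟩ ⟨k1, k2, k3⟩
    refine ⟨k1.trans h1, k2, ?_⟩
    have : m (G \ G'') ≤ m (G' \ G'') + m (G \ G') := by
      refine (measure_mono ?_).trans (measure_union_le _ _)
      intro x hx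
      by_cases h : x ∈ G'
      · exact Or.inl ⟨h, hx.2⟩
      · exact Or.inr ⟨hx.1, h⟩
    calc perimeter m G'' + c * m (G \ G'')
        ≤ perimeter m G'' + c * (m (G' \ G'') + m (G \ G')) := by gcongr
      _ = perimeter m G'' + c * m (G' \ G'') + c * m (G \ G') := by ring
      _ ≤ perimeter m G' + c * m (G \ G') := by gcongr
      _ ≤ _ := h3
  have hSle : ∀ {G G'}, G' ∈ S G → perimeter m G' ≤ perimeter m G := fun h =>
    le_self_add.trans h.2.2
  -- Each step takes a nearly least perimeter among the successors; the minimizer is the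
  -- intersection of the resulting decreasing sequence.
  have hstep : ∀ (k : ℕ) (G : {G : Set X // G ∈ S G₀}), ∃ G' : {G : Set X // G ∈ S G₀},
      G'.1 ∈ S G.1 ∧ ∀ H ∈ S G.1, perimeter m G'.1 ≤ perimeter m H + (k + 1 : ℝ≥0∞)⁻¹ := by
    rintro k ⟨G, hG⟩
    have hne : (⨅ H ∈ S G, perimeter m H) ≠ ∞ :=
      ne_top_of_le_ne_top hP ((iInf₂_le G (hSself hG.2.1)).trans (hSle hG))
    have := ENNReal.lt_add_right hne (show (k + 1 : ℝ≥0∞)⁻¹ ≠ 0 by simp)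
    simp only [iInf_lt_iff] at this
    obtain ⟨G', hG', hlt⟩ := this
    refine ⟨⟨G', hStrans hG hG'⟩, hG', fun H hH => hlt.le.trans ?_⟩
    gcongr
    exact iInf₂_le H hH
  choose next hnext hnext' using hstep
  obtain ⟨K, hK0, hKs⟩ : ∃ K : ℕ → {G : Set X // G ∈ S G₀}, (K 0).1 = G₀ ∧
      ∀ k, K (k + 1) = next k (K k) :=
    ⟨fun k => Nat.rec ⟨G₀, hSself h₀⟩ (fun k G => next k G) k, rfl, fun _ => rfl⟩
  have hKmem : ∀ {i j}, i ≤ j → (K j).1 ∈ S (K i).1 := by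
    intro i j hij
    induction j, hij using Nat.le_induction with
    | base => exact hSself (K i).2.2.1
    | succ j _ ih => exact hStrans ih (by rw [hKs]; exact hnext _ _)
  have hanti : Antitone fun k => (K k).1 := fun i j hij => (hKmem hij).1
  have hcl : ∀ k, IsClosed (K k).1 := fun k => (K k).2.2.1
  have hms : ∀ k, MeasurableSet (K k).1 := fun k => (hcl k).measurableSet
  set G := ⋂ k, (K k).1 with hG
  have hPle : ∀ j, perimeter m G ≤ perimeter m (K j).1 := fun j =>
    perimeter_iInter_le hanti hms (by rwa [hK0])
      ((eventually_ge_atTop j).mono fun k hk => hSle (hKmem hk))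
  have hGcl : IsClosed G := isClosed_iInter hcl
  have hGS : ∀ k, G ∈ S (K k).1 := by
    intro k
    refine ⟨iInter_subset _ _, hGcl, ?_⟩
    have h1 : Tendsto (fun j => perimeter m G + c * m ((K k).1 \ (K j).1)) atTop
        (𝓝 (perimeter m G + c * m ((K k).1 \ G))) := by
      refine tendsto_const_nhds.add (ENNReal.Tendsto.const_mul ?_ (Or.inr ENNReal.coe_ne_top))
      rw [hG, sdiff_iInter]
      exact tendsto_measure_iUnion_atTop fun i j hij => sdiff_subset_sdiff_right (hanti hij)
    refine le_of_tendsto h1 ((eventually_ge_atTop k).mono fun j hj => ?_)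
    exact (add_le_add_left (hPle j) _).trans (hKmem hj).2.2
  have hG0 := hGS 0
  rw [hK0] at hG0
  refine ⟨G, hG0.1, hGcl, hG0.2.2, fun G' hG' hcl' => ?_⟩
  by_contra hlt
  rw [not_le] at hlt
  have hG'S : G' ∈ S G := ⟨hG', hcl', hlt.le⟩
  -- A strictly better competitor `G'` would succeed every `K k`, so near-minimality of `K (k + 1)`
  -- bounds `perimeter m G` by `perimeter m G'` up to `(k + 1)⁻¹`.
  have hPP : perimeter m G ≤ perimeter m G' := by
    refine ENNReal.le_of_forall_pos_le_add fun ε hε _ => ?_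
    have ht : Tendsto (fun n : ℕ => (n + 1 : ℝ≥0∞)⁻¹) atTop (𝓝 0) := by
      simpa using (tendsto_add_atTop_iff_nat 1).2 ENNReal.tendsto_inv_nat_nhds_zero
    obtain ⟨k, hk⟩ := (ht.eventually_le_const (show (0 : ℝ≥0∞) < ε by exact_mod_cast hε)).exists
    calc perimeter m G ≤ perimeter m (K (k + 1)).1 := hPle _
      _ ≤ perimeter m G' + (k + 1 : ℝ≥0∞)⁻¹ := by
        rw [hKs]; exact hnext' k (K k) G' (hStrans (hGS k) hG'S)
      _ ≤ _ := by gcongr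
  exact absurd (hPP.trans le_self_add) (not_le.2 hlt)

/-- Every closed set has closed neighbourhoods of finite perimeter and nearly the same measure. -/
theorem exists_isClosed_perimeter_ne_top [SFinite m]
    (hm : ∀ s : Set X, Bornology.IsBounded s → m s < ∞) {K : Set X} (hK : IsClosed K)
    (hKb : Bornology.IsBounded K) {ε : ℝ≥0∞} (hε : ε ≠ 0) :
    ∃ G, K ⊆ G ∧ IsClosed G ∧ m G ≠ ∞ ∧ perimeter m G ≠ ∞ ∧ m (G \ K) < ε := by
  obtain rfl | hne := K.eq_empty_or_nonempty
  · exact ⟨∅, Subset.rfl, isClosed_empty, by simp, by simp [perimeter], by simpa using hε.bot_lt⟩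
  have hc :=
    tendsto_measure_cthickening_of_isClosed (μ := m) ⟨1, one_pos, (hm _ hKb.cthickening).ne⟩ hK
  obtain ⟨s, hs, hs0⟩ := (((tendsto_nhdsWithin_of_tendsto_nhds hc).eventually_lt_const
    (ENNReal.lt_add_right (hm K hKb).ne hε)).and (self_mem_nhdsWithin (s := Ioi (0 : ℝ)))).exists
  have hCm : m (Metric.cthickening s K) ≠ ∞ := (hm _ hKb.cthickening).ne
  have hmem : ∀ x, Metric.infDist x K ≤ s → x ∈ Metric.cthickening s K := fun x hx => by
    rw [Metric.mem_cthickening_iff]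
    exact (ENNReal.le_ofReal_iff_toReal_le (Metric.infEDist_ne_top hne) hs0.le).2 hx
  -- Its superlevel sets at levels in `(0, s)` are closed and lie between `K` and its
  -- `s`-thickening.
  set w : X → ℝ := fun x => max 0 (s - Metric.infDist x K) with hwdef
  have hw1 : LipschitzWith 1 w := by
    have := ((LipschitzWith.const (α := X) s).sub (Metric.lipschitz_infDist_pt K)).const_max 0
    simpa using this
  have hwfin : ∀ x, asympLip w x ≠ ∞ := fun x =>
    ne_top_of_le_ne_top ENNReal.coe_ne_top (asympLip_le_of_lipschitzWith hw1 x)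
  have hw0 : ∀ x, w x ∈ Icc 0 s := fun x =>
    ⟨le_max_left _ _, max_le hs0.le (by linarith [Metric.infDist_nonneg (x := x) (s := K)])⟩
  have hE : energy m w ≠ ∞ := by
    refine ne_top_of_le_ne_top hCm ?_
    rw [← lintegral_indicator_one Metric.isClosed_cthickening.measurableSet]
    refine lintegral_mono fun x => ?_
    by_cases hx : x ∈ Metric.cthickening s K
    · rw [indicator_of_mem hx]
      exact asympLip_le_of_lipschitzWith hw1 x
    · refine le_trans (le_of_eq (asympLip_eq_zero_of_eventuallyEq_const (c := 0) ?_)) zero_le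
      filter_upwards [Metric.isClosed_cthickening.isOpen_compl.mem_nhds hx] with y hy
      refine max_eq_left ?_
      linarith [not_le.1 (mt (hmem y) hy)]
  have hwi : Integrable w m := by
    refine ⟨hw1.continuous.aestronglyMeasurable, ?_⟩
    refine lt_of_le_of_lt (b := ENNReal.ofReal s * m (Metric.cthickening s K)) ?_
      (ENNReal.mul_lt_top ENNReal.ofReal_lt_top hCm.lt_top)
    rw [← lintegral_indicator_const Metric.isClosed_cthickening.measurableSet]
    refine lintegral_mono fun x => ?_
    by_cases hx : x ∈ Metric.cthickening s K
    · rw [indicator_of_mem hx, Real.enorm_eq_ofReal (hw0 x).1]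
      exact ENNReal.ofReal_le_ofReal (hw0 x).2
    · have : w x = 0 := max_eq_left (by linarith [not_le.1 (mt (hmem x) hx)])
      simp [this]
  -- For a constant sequence the L¹ error vanishes; `p` is then integrable, hence finite at some
  -- level in `(0, s)`.
  obtain ⟨p, hpm, hp, hpt⟩ := exists_lintegral_le_liminf_energy (m := m) (w := fun _ => w)
    (fun _ => hwfin) hw1.continuous.measurable hwi (by simp)
  rw [liminf_const] at hp
  obtain ⟨t, ht, htp⟩ : ∃ t ∈ Ioo 0 s, p t < ∞ := by
    by_contra! h
    have h1 : ∀ᵐ t, p t < ∞ := ae_lt_top hpm (ne_top_of_le_ne_top hE hp)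
    have h2 : volume (Ioo 0 s) = 0 := by
      refine measure_mono_null (fun t ht => ?_) (ae_iff.1 h1)
      exact not_lt.2 (h t ht)
    rw [Real.volume_Ioo] at h2
    simp [hs0.not_ge] at h2
  have hsub : {x | t ≤ w x} ⊆ Metric.cthickening s K := fun x hx => by
    refine hmem x ?_
    by_contra! h
    have : w x = 0 := max_eq_left (by linarith)
    exact absurd (this ▸ hx : t ≤ 0) (not_le.2 ht.1)
  refine ⟨{x | t ≤ w x}, fun x hx => ?_, isClosed_le continuous_const hw1.continuous,
    measure_ne_top_of_subset hsub hCm, ne_top_of_le_ne_top htp.ne (hpt t ht.1), ?_⟩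
  · refine le_trans ?_ (le_max_right 0 (s - Metric.infDist x K))
    rw [Metric.infDist_zero_of_mem hx, sub_zero]
    exact ht.2.le
  · refine (measure_mono (sdiff_subset_sdiff_left hsub)).trans_lt ?_
    rw [measure_sdiff (Metric.self_subset_cthickening K) hK.nullMeasurableSet (hm K hKb).ne]
    exact ENNReal.sub_lt_of_lt_add (measure_mono (Metric.self_subset_cthickening K))
      (by rwa [add_comm])

end minimizer

/-! ### Zero extension of bounded functions that are locally Lipschitz around a minimizer -/

theorem liminf_add_liminf_le (a b : ℕ → ℝ≥0∞) :
    liminf a atTop + liminf b atTop ≤ liminf (fun n => a n + b n) atTop := by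
  simp only [liminf_eq_iSup_iInf_of_nat]
  rw [ENNReal.iSup_add_iSup_of_monotone]
  · exact iSup_mono fun n => le_iInf₂ fun i hi => add_le_add (iInf₂_le i hi) (iInf₂_le i hi)
  all_goals
  · intro i j hij
    exact le_iInf₂ fun k hk => iInf₂_le k (hij.trans hk)

section zeroExtension

variable {X : Type*} [MetricSpace X] {G A : Set X}

/-- `G` may have distance zero from the complement of `A`, so only local Lipschitz bounds are
possible. A ramp applied to the Urysohn quotient `b / (a + b)` makes it constant near `G` and near
each point outside `A`. -/
theorem exists_locallyLipschitz_cutoff (hG : IsClosed G) (hA : IsOpen A) (hGA : G ⊆ A) :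
    ∃ ψ : X → ℝ, (∀ x, asympLip ψ x ≠ ∞) ∧ (∀ x, ψ x ∈ Icc (0 : ℝ) 1) ∧
      (∀ x ∈ G, ψ =ᶠ[𝓝 x] fun _ => 1) ∧ ∀ x ∉ A, ψ =ᶠ[𝓝 x] fun _ => 0 := by
  have key : ∀ U : Set X, IsOpen U → ∃ r : X → ℝ, LipschitzWith 1 r ∧ (∀ x, 0 ≤ r x) ∧
      (∀ x ∈ U, 0 < r x) ∧ ∀ x ∉ U, r x = 0 := by
    classical
    intro U hU
    -- The weight is infinite off `U` and zero on `U`, so `r` vanishes exactly off `U`.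
    obtain ⟨r, hr, hr0, -, hr1, hr2⟩ := exists_lipschitzWith_le_div (Uᶜ.indicator fun _ => ∞)
    refine ⟨r, hr, hr0, fun x hx => hr2 x ⟨0, ?_⟩, fun x hx => ?_⟩
    · filter_upwards [hU.mem_nhds hx] with y hy
      simp [hy]
    · by_contra h
      have := hr1 x (lt_of_le_of_ne (hr0 x) (Ne.symm h))
      rw [indicator_of_mem hx] at this
      exact ENNReal.ofReal_ne_top (top_le_iff.1 this)
  obtain ⟨a, ha, ha0, hap, haz⟩ := key Gᶜ hG.isOpen_compl
  obtain ⟨b, hb, hb0, hbp, hbz⟩ := key A hA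
  have hpos : ∀ x, a x + b x ≠ 0 := fun x => by
    by_cases hx : x ∈ A
    · exact (add_pos_of_nonneg_of_pos (ha0 x) (hbp x hx)).ne'
    · exact (add_pos_of_pos_of_nonneg (hap x fun h => hx (hGA h)) (hb0 x)).ne'
  have hafin : ∀ x, asympLip a x ≠ ∞ := fun x =>
    ne_top_of_le_ne_top ENNReal.coe_ne_top (asympLip_le_of_lipschitzWith ha x)
  have hbfin : ∀ x, asympLip b x ≠ ∞ := fun x =>
    ne_top_of_le_ne_top ENNReal.coe_ne_top (asympLip_le_of_lipschitzWith hb x)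
  have hab : ∀ x, asympLip (fun y => a y + b y) x ≠ ∞ := fun x =>
    ne_top_of_le_ne_top (ENNReal.add_ne_top.2 ⟨hafin x, hbfin x⟩) (asympLip_add_le a b x)
  have hinv : ∀ x, asympLip (fun y => (a y + b y)⁻¹) x ≠ ∞ := fun x =>
    asympLip_inv_ne_top (hab x) (hpos x)
  have hq : ∀ x, asympLip (fun y => b y * (a y + b y)⁻¹) x ≠ ∞ := fun x =>
    ne_top_of_le_ne_top (ENNReal.add_ne_top.2 ⟨ENNReal.mul_ne_top enorm_ne_top (hinv x),
      ENNReal.mul_ne_top enorm_ne_top (hbfin x)⟩) (asympLip_mul_le (hbfin x) (hinv x))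
  have hqc : Continuous fun y => b y * (a y + b y)⁻¹ := continuous_of_asympLip_ne_top hq
  have h13 : (0 : ℝ) < 1 / 3 := by norm_num
  refine ⟨fun x => ramp (2 / 3) (1 / 3) (b x * (a x + b x)⁻¹), fun x =>
    ne_top_of_le_ne_top (ENNReal.mul_ne_top ENNReal.coe_ne_top (hq x))
      (asympLip_comp_le (lipschitzWith_ramp (2 / 3) h13) _ x (hq x)),
    fun x => ramp_mem_Icc _ _ _, fun x hx => ?_, fun x hx => ?_⟩
  · have h1 : b x * (a x + b x)⁻¹ = 1 := by
      have := hpos x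
      rw [haz x (by simpa using hx), zero_add] at this ⊢
      exact mul_inv_cancel₀ this
    filter_upwards [(hqc.tendsto x).eventually_const_lt (show (2 / 3 : ℝ) < _ by
      rw [h1]; norm_num)] with y hy
    exact ramp_eq_one h13 hy.le
  · have h1 : b x * (a x + b x)⁻¹ = 0 := by rw [hbz x hx, zero_mul]
    filter_upwards [(hqc.tendsto x).eventually_lt_const (show _ < (1 / 3 : ℝ) by
      rw [h1]; norm_num)] with y hy
    exact ramp_eq_zero h13 (by linarith)

theorem exists_eventually_asympLip_le {u : X → ℝ} {x : X} (h : asympLip u x ≠ ∞) :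
    ∃ C : ℝ≥0, ∀ᶠ y in 𝓝 x, asympLip u y ≤ C := by
  obtain ⟨C, hC, -⟩ := ENNReal.lt_iff_exists_nnreal_btwn.1 h.lt_top
  exact ⟨C, (upperSemicontinuous_asympLip u x C hC).mono fun y hy => hy.le⟩

/-- The products of `u` and `M - u` with a function `ψ * ρ` that vanishes near the complement of `A`
are locally Lipschitz, and their asymptotic Lipschitz constants add up to the expected amount. -/
theorem asympLip_mul_cutoff_add_le (hA : IsOpen A) {ψ ρ u : X → ℝ}
    (hψ : ∀ x, asympLip ψ x ≠ ∞) (hψ01 : ∀ x, ψ x ∈ Icc (0 : ℝ) 1)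
    (hψ0 : ∀ x ∉ A, ψ =ᶠ[𝓝 x] fun _ => 0) (hρ : ∀ x, asympLip ρ x ≠ ∞)
    (hu : LocallyLipschitzOn A u) {M : ℝ} (hM : ∀ x, u x ∈ Icc 0 M) (x : X) :
    asympLip (fun y => u y * (ψ y * ρ y)) x + asympLip (fun y => (M - u y) * (ψ y * ρ y)) x ≤
      ENNReal.ofReal M * asympLip ρ x + ‖ρ x‖ₑ *
        (ENNReal.ofReal M * asympLip ψ x + 2 * (‖ψ x‖ₑ * asympLip u x)) ∧
      asympLip (fun y => u y * (ψ y * ρ y)) x ≠ ∞ ∧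
      asympLip (fun y => (M - u y) * (ψ y * ρ y)) x ≠ ∞ := by
  by_cases hx : x ∈ A
  · have hux := asympLip_ne_top_of_locallyLipschitzOn hA hu hx
    have hux' : asympLip (fun y => M - u y) x = asympLip u x := by
      rw [← asympLip_neg u, ← asympLip_sub_const (fun y => -u y) (-M)]
      congr 1; ext y; ring
    have hψ1 : ‖ψ x‖ₑ ≤ 1 := by
      rw [Real.enorm_eq_ofReal (hψ01 x).1, ← ENNReal.ofReal_one]
      exact ENNReal.ofReal_le_ofReal (hψ01 x).2
    have h1 := asympLip_mul_le (hψ x) (hρ x)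
    have hσ : asympLip (fun y => ψ y * ρ y) x ≠ ∞ := ne_top_of_le_ne_top
      (ENNReal.add_ne_top.2 ⟨ENNReal.mul_ne_top enorm_ne_top (hρ x),
        ENNReal.mul_ne_top enorm_ne_top (hψ x)⟩) h1
    have h2 := asympLip_mul_le hux hσ
    have h3 := asympLip_mul_le (u := fun y => M - u y) (hux' ▸ hux) hσ
    rw [hux'] at h3
    refine ⟨?_, ne_top_of_le_ne_top (ENNReal.add_ne_top.2 ⟨ENNReal.mul_ne_top enorm_ne_top hσ,
      ENNReal.mul_ne_top enorm_ne_top hux⟩) h2, ne_top_of_le_ne_top (ENNReal.add_ne_top.2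
      ⟨ENNReal.mul_ne_top enorm_ne_top hσ, ENNReal.mul_ne_top enorm_ne_top hux⟩) h3⟩
    -- The coefficient of `asympLip ρ` must be exactly `M`: any larger constant would spoil the
    -- later cancellation of `M` times the perimeter.
    have hsum : ‖u x‖ₑ + ‖M - u x‖ₑ = ENNReal.ofReal M := by
      rw [Real.enorm_eq_ofReal (hM x).1, Real.enorm_eq_ofReal (by linarith [(hM x).2]),
        ← ENNReal.ofReal_add (hM x).1 (by linarith [(hM x).2])]
      congr 1; ring
    rw [enorm_mul] at h2 h3
    calc _ ≤ _ := add_le_add h2 h3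
      _ = (‖u x‖ₑ + ‖M - u x‖ₑ) * asympLip (fun y => ψ y * ρ y) x +
          ‖ρ x‖ₑ * (2 * (‖ψ x‖ₑ * asympLip u x)) := by ring
      _ ≤ ENNReal.ofReal M * (1 * asympLip ρ x + ‖ρ x‖ₑ * asympLip ψ x) +
          ‖ρ x‖ₑ * (2 * (‖ψ x‖ₑ * asympLip u x)) := by
        rw [hsum]
        gcongr
        exact h1.trans (by gcongr)
      _ = _ := by ring
  · have h1 : asympLip (fun y => u y * (ψ y * ρ y)) x = 0 :=
      asympLip_eq_zero_of_eventuallyEq_const (c := 0)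
        (by filter_upwards [hψ0 x hx] with y hy; simp [hy])
    have h2 : asympLip (fun y => (M - u y) * (ψ y * ρ y)) x = 0 :=
      asympLip_eq_zero_of_eventuallyEq_const (c := 0)
        (by filter_upwards [hψ0 x hx] with y hy; simp [hy])
    simp [h1, h2]

variable [MeasurableSpace X] [BorelSpace X] {m : Measure X}

theorem measurable_indicator_of_continuousOn {f : X → ℝ} (hG : MeasurableSet G)
    (hf : ContinuousOn f G) : Measurable (G.indicator f) := by
  classical
  rw [← piecewise_eq_indicator]
  exact hf.measurable_piecewise continuousOn_const hG

/-- The minimality of `G`, integrated over the superlevel sets of a function on `G`. -/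
theorem perimeter_le_liminf_energy_add [SFinite m] (hG : IsClosed G) (hGm : m G ≠ ∞) {c : ℝ≥0}
    (hmin : ∀ G' ⊆ G, IsClosed G' → perimeter m G ≤ perimeter m G' + c * m (G \ G'))
    {u : X → ℝ} (hu : ContinuousOn u G) {M : ℝ} (hM : ∀ x, u x ∈ Icc 0 M)
    {w : ℕ → X → ℝ} (hw : ∀ n x, asympLip (w n) x ≠ ∞)
    (hd : ∀ n, ∫⁻ x, ‖w n x - G.indicator (fun y => M - u y) x‖ₑ ∂m ≤ (((n : ℝ≥0∞) + 1) ^ 2)⁻¹) :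
    ENNReal.ofReal M * perimeter m G ≤
      liminf (fun n => energy m (w n)) atTop + c * ∫⁻ x in G, ‖u x‖ₑ ∂m := by
  have hvm : Measurable (G.indicator fun y => M - u y) :=
    measurable_indicator_of_continuousOn hG.measurableSet (continuousOn_const.sub hu)
  have hvi : Integrable (G.indicator fun y => M - u y) m := by
    refine ⟨hvm.aestronglyMeasurable, ?_⟩
    refine lt_of_le_of_lt (b := ENNReal.ofReal M * m G) ?_
      (ENNReal.mul_lt_top ENNReal.ofReal_lt_top hGm.lt_top)
    rw [← lintegral_indicator_const hG.measurableSet]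
    refine lintegral_mono fun x => ?_
    rw [enorm_indicator_eq_indicator_enorm]
    refine indicator_le_indicator ?_
    rw [Real.enorm_eq_ofReal (by linarith [(hM x).2])]
    exact ENNReal.ofReal_le_ofReal (by linarith [(hM x).1])
  obtain ⟨p, hpm, hp, hpt⟩ := exists_lintegral_le_liminf_energy hw hvm hvi hd
  have hpt' : ∀ s ∈ Ioo 0 M, perimeter m G ≤
      p (M - s) + c * m {x | s < G.indicator u x} := by
    intro s hs
    -- The superlevel set is a closed subset of `G`, hence an admissible competitor; points outside
    -- `G` drop out because `M - s > 0`.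
    have e1 : {x | M - s ≤ G.indicator (fun y => M - u y) x} = G ∩ u ⁻¹' Iic s := by
      ext x
      by_cases hx : x ∈ G
      · simp only [mem_ofPred_eq, indicator_of_mem hx, mem_inter_iff, hx, true_and, mem_preimage,
          mem_Iic]
        constructor <;> intro h <;> linarith
      · simp [hx, hs.2]
    have e2 : G \ (G ∩ u ⁻¹' Iic s) = {x | s < G.indicator u x} := by
      ext x
      by_cases hx : x ∈ G
      · simp [hx]
      · simp [hx, hs.1.le]
    have h1 := hpt (M - s) (sub_pos.2 hs.2)
    have h2 := hmin _ inter_subset_left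
      (hu.preimage_isClosed_of_isClosed hG (isClosed_Iic (a := s)))
    rw [e2] at h2
    rw [e1] at h1
    exact h2.trans (add_le_add_left h1 _)
  have hlayer : ∫⁻ s in Ioi 0, m {x | s < G.indicator u x} = ∫⁻ x in G, ‖u x‖ₑ ∂m := by
    have h0 : ∀ x, 0 ≤ G.indicator u x := fun x => indicator_nonneg (fun y _ => (hM y).1) x
    rw [← lintegral_eq_lintegral_meas_lt m (Eventually.of_forall h0) 
      (measurable_indicator_of_continuousOn hG.measurableSet hu).aemeasurable,
      ← lintegral_indicator hG.measurableSet]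
    refine lintegral_congr fun x => ?_
    by_cases hx : x ∈ G
    · simp [hx, Real.enorm_eq_ofReal (hM x).1]
    · simp [hx]
  calc ENNReal.ofReal M * perimeter m G = ∫⁻ _ in Ioo 0 M, perimeter m G := by
        rw [setLIntegral_const, Real.volume_Ioo, sub_zero, mul_comm]
    _ ≤ ∫⁻ s in Ioo 0 M, (p (M - s) + c * m {x | s < G.indicator u x}) :=
        setLIntegral_mono' measurableSet_Ioo hpt'
    _ = (∫⁻ s in Ioo 0 M, p (M - s)) + c * ∫⁻ s in Ioo 0 M, m {x | s < G.indicator u x} := by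
        rw [← lintegral_const_mul' _ _ ENNReal.coe_ne_top]
        exact lintegral_add_left (hpm.comp (measurable_const.sub measurable_id)) _
    _ ≤ (∫⁻ s, p (M - s)) + c * ∫⁻ s in Ioi 0, m {x | s < G.indicator u x} := by
        gcongr
        · exact Measure.restrict_le_self
        · exact Ioo_subset_Ioi_self
    _ ≤ _ := by
        rw [lintegral_sub_left_eq_self p M, hlayer]
        gcongr

/-- If `G` is a closed set that minimizes the perimeter plus the removed measure, then bounded
nonnegative functions that are locally Lipschitz around `G` have a zero extension whose relaxed
energy is controlled. -/
theorem relaxedEnergy_indicator_le_of_nonneg [SFinite m] (hG : IsClosed G) (hGm : m G ≠ ∞)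
    (hP : perimeter m G ≠ ∞) {c : ℝ≥0}
    (hmin : ∀ G' ⊆ G, IsClosed G' → perimeter m G ≤ perimeter m G' + c * m (G \ G'))
    (hA : IsOpen A) (hGA : G ⊆ A) {u : X → ℝ} (hu : LocallyLipschitzOn A u) {M : ℝ}
    (hM : ∀ x, u x ∈ Icc 0 M) : relaxedEnergy m (G.indicator u) ≤
      2 * ∫⁻ x in G, asympLip u x ∂m + c * ∫⁻ x in G, ‖u x‖ₑ ∂m := by
  obtain ⟨ψ, hψ, hψ01, hψ1, hψ0⟩ := exists_locallyLipschitz_cutoff hG hA hGA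
  -- In the product rule `g` multiplies `‖ρ n‖ₑ`. On `G` it equals `2 * asympLip u`; elsewhere it is
  -- only locally bounded, which forces the weighted approximation.
  set g : X → ℝ≥0∞ := fun x => ENNReal.ofReal M * asympLip ψ x + 2 * (‖ψ x‖ₑ * asympLip u x) with hg
  have hgm : Measurable g := by
    have := (continuous_of_asympLip_ne_top hψ).measurable.enorm
    exact ((measurable_asympLip ψ).const_mul _).add ((this.mul (measurable_asympLip u)).const_mul _)
  have hψ1' : ∀ x, ‖ψ x‖ₑ ≤ 1 := fun x => by
    rw [Real.enorm_eq_ofReal (hψ01 x).1, ← ENNReal.ofReal_one]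
    exact ENNReal.ofReal_le_ofReal (hψ01 x).2
  have hgG : ∀ x ∈ G, g x = 2 * asympLip u x := fun x hx => by
    simp [hg, asympLip_eq_zero_of_eventuallyEq_const (hψ1 x hx), (hψ1 x hx).self_of_nhds]
  have hgloc : ∀ x, ∃ C : ℝ≥0, ∀ᶠ y in 𝓝 x, g y ≤ C := by
    intro x
    by_cases hx : x ∈ A
    · obtain ⟨C, hC⟩ := exists_eventually_asympLip_le (hψ x)
      obtain ⟨D, hD⟩ := exists_eventually_asympLip_le
        (asympLip_ne_top_of_locallyLipschitzOn hA hu hx)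
      refine ⟨Real.toNNReal M * C + 2 * (1 * D), ?_⟩
      filter_upwards [hC, hD] with y hy hy'
      push_cast
      change ENNReal.ofReal M * asympLip ψ y + _ ≤ ENNReal.ofReal M * C + _
      gcongr
      exact hψ1' y
    · refine ⟨0, ?_⟩
      filter_upwards [(hψ0 x hx).eventually_nhds] with y hy
      simp [hg, asympLip_eq_zero_of_eventuallyEq_const hy, hy.self_of_nhds]
  set χ : X → ℝ := G.indicator fun _ => 1 with hχ
  have hχm : Measurable χ := measurable_const.indicator hG.measurableSet
  -- After multiplication by at most `1 + M` the errors meet the rate `(n + 1)⁻²` required by the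
  -- coarea inequality.
  set δ : ℕ → ℝ≥0∞ := fun n => (((n : ℝ≥0∞) + 1) ^ 2)⁻¹ / (1 + ENNReal.ofReal M) with hδ
  have hδ0 : ∀ n, δ n ≠ 0 := fun n => ENNReal.div_ne_zero.2
    ⟨ENNReal.inv_ne_zero.2 (by finiteness), by finiteness⟩
  have hδM : ∀ n, (1 + ENNReal.ofReal M) * δ n = (((n : ℝ≥0∞) + 1) ^ 2)⁻¹ := fun n =>
    ENNReal.mul_div_cancel (by simp) (by finiteness)
  choose ρ hρ hρd hρe using fun n => exists_energy_le_weighted hχm hP hgloc (hδ0 n)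
  have hadd : ∀ n x, _ := fun n x => asympLip_mul_cutoff_add_le hA hψ hψ01 hψ0 (hρ n) hu hM x
  set z : ℕ → X → ℝ := fun n y => u y * (ψ y * ρ n y) with hz
  set w : ℕ → X → ℝ := fun n y => (M - u y) * (ψ y * ρ n y) with hw
  have hρd1 : ∀ n, ∫⁻ x, ‖ρ n x - χ x‖ₑ ∂m ≤ δ n := fun n =>
    (lintegral_mono fun x => le_mul_of_one_le_left zero_le le_self_add).trans (hρd n)
  have hdist : ∀ (f : X → ℝ), (∀ x, f x ∈ Icc 0 M) → ∀ n,
      ∫⁻ x, ‖f x * (ψ x * ρ n x) - G.indicator f x‖ₑ ∂m ≤ (((n : ℝ≥0∞) + 1) ^ 2)⁻¹ := by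
    intro f hf n
    calc ∫⁻ x, ‖f x * (ψ x * ρ n x) - G.indicator f x‖ₑ ∂m
        ≤ ∫⁻ x, ENNReal.ofReal M * ‖ρ n x - χ x‖ₑ ∂m := by
          refine lintegral_mono fun x => ?_
          have e : f x * (ψ x * ρ n x) - G.indicator f x = f x * (ψ x * (ρ n x - χ x)) := by
            by_cases hx : x ∈ G
            · simp [hχ, hx, (hψ1 x hx).self_of_nhds, mul_sub]
            · simp [hχ, hx]
          rw [e, enorm_mul, enorm_mul]
          refine mul_le_mul' ?_ (mul_le_of_le_one_left zero_le (hψ1' x))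
          rw [Real.enorm_eq_ofReal (hf x).1]
          exact ENNReal.ofReal_le_ofReal (hf x).2
      _ = ENNReal.ofReal M * ∫⁻ x, ‖ρ n x - χ x‖ₑ ∂m :=
          lintegral_const_mul' _ _ ENNReal.ofReal_ne_top
      _ ≤ (1 + ENNReal.ofReal M) * δ n := mul_le_mul' le_add_self (hρd1 n)
      _ = _ := hδM n
  have hsq : Tendsto (fun n : ℕ => (((n : ℝ≥0∞) + 1) ^ 2)⁻¹) atTop (𝓝 0) := by
    have h1 : Tendsto (fun n : ℕ => ((n : ℝ≥0∞) + 1)⁻¹) atTop (𝓝 0) := by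
      simpa using (tendsto_add_atTop_iff_nat 1).2 ENNReal.tendsto_inv_nat_nhds_zero
    refine tendsto_of_tendsto_of_tendsto_of_le_of_le tendsto_const_nhds h1 (fun _ => zero_le)
      fun n => ENNReal.inv_le_inv.2 (le_self_pow₀ le_add_self two_ne_zero)
  have hzW : relaxedEnergy m (G.indicator u) ≤ liminf (fun n => energy m (z n)) atTop :=
    relaxedEnergy_le_liminf (fun n x => (hadd n x).2.1)
      (tendsto_of_tendsto_of_tendsto_of_le_of_le tendsto_const_nhds hsq (fun _ => zero_le)
        (hdist u hM))
  have hwP := perimeter_le_liminf_energy_add hG hGm hmin (hu.continuousOn.mono hGA) hM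
    (fun n x => (hadd n x).2.2)
    (hdist (fun y => M - u y) fun x => ⟨by linarith [(hM x).2], by linarith [(hM x).1]⟩)
  have hup : ∀ n, energy m (z n) + energy m (w n) ≤ ENNReal.ofReal M * perimeter m G +
      2 * ∫⁻ x in G, asympLip u x ∂m + (((n : ℝ≥0∞) + 1) ^ 2)⁻¹ := by
    intro n
    calc energy m (z n) + energy m (w n)
        = ∫⁻ x, (asympLip (z n) x + asympLip (w n) x) ∂m :=
          (lintegral_add_left (measurable_asympLip _) _).symm
      _ ≤ ∫⁻ x, (ENNReal.ofReal M * asympLip (ρ n) x + (G.indicator (fun y => 2 * asympLip u y) x +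
            (1 + g x) * ‖ρ n x - χ x‖ₑ)) ∂m := by
          refine lintegral_mono fun x => (hadd n x).1.trans ?_
          refine add_le_add_right ?_ _
          by_cases hx : x ∈ G
          · rw [indicator_of_mem hx, ← hgG x hx]
            calc ‖ρ n x‖ₑ * g x ≤ (1 + ‖ρ n x - χ x‖ₑ) * g x := by
                  gcongr
                  have : ρ n x = χ x + (ρ n x - χ x) := by ring
                  rw [this]
                  refine (enorm_add_le _ _).trans ?_
                  simp [hχ, hx]
              _ = g x + g x * ‖ρ n x - χ x‖ₑ := by ring
              _ ≤ _ := by gcongr; exact le_add_self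
          · rw [indicator_of_notMem hx, zero_add]
            simp only [hχ, indicator_of_notMem hx, sub_zero]
            rw [mul_comm]
            exact mul_le_mul' le_add_self le_rfl
      _ = ENNReal.ofReal M * energy m (ρ n) + (2 * ∫⁻ x in G, asympLip u x ∂m +
            ∫⁻ x, (1 + g x) * ‖ρ n x - χ x‖ₑ ∂m) := by
          rw [lintegral_add_left ((measurable_asympLip _).const_mul _),
            lintegral_add_left (((measurable_asympLip u).const_mul 2).indicator hG.measurableSet),
            lintegral_const_mul _ (measurable_asympLip _), lintegral_indicator hG.measurableSet,
            lintegral_const_mul _ (measurable_asympLip _), energy]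
      _ ≤ ENNReal.ofReal M * (perimeter m G + δ n) + (2 * ∫⁻ x in G, asympLip u x ∂m + δ n) := by
          gcongr
          · exact hρe n
          · exact hρd n
      _ = ENNReal.ofReal M * perimeter m G + 2 * ∫⁻ x in G, asympLip u x ∂m +
            (1 + ENNReal.ofReal M) * δ n := by ring
      _ = _ := by rw [hδM]
  have hlim : liminf (fun n => energy m (z n)) atTop + liminf (fun n => energy m (w n)) atTop ≤
      ENNReal.ofReal M * perimeter m G + 2 * ∫⁻ x in G, asympLip u x ∂m := by
    refine (liminf_add_liminf_le _ _).trans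
      ((liminf_le_liminf (Eventually.of_forall hup)).trans (le_of_eq ?_))
    simpa using (tendsto_const_nhds.add hsq).liminf_eq
  have hfin : ENNReal.ofReal M * perimeter m G ≠ ∞ := ENNReal.mul_ne_top ENNReal.ofReal_ne_top hP
  -- The upper bound from the product rule and the lower bound from minimality share this finite
  -- term, so it can be cancelled.
  refine (ENNReal.add_le_add_iff_left hfin).1 ?_
  calc ENNReal.ofReal M * perimeter m G + relaxedEnergy m (G.indicator u)
      ≤ (liminf (fun n => energy m (w n)) atTop + c * ∫⁻ x in G, ‖u x‖ₑ ∂m) +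
        liminf (fun n => energy m (z n)) atTop := add_le_add hwP hzW
    _ = (liminf (fun n => energy m (z n)) atTop + liminf (fun n => energy m (w n)) atTop) +
        c * ∫⁻ x in G, ‖u x‖ₑ ∂m := by ring
    _ ≤ _ := by
      rw [← add_assoc]
      exact add_le_add_left hlim _

end zeroExtension

/-! ### Truncation and passage to general BV functions -/

section truncation

/-- Truncation of a real number at the levels `-M` and `M`. -/
noncomputable def clip (M s : ℝ) : ℝ := max (-M) (min M s)

theorem lipschitzWith_clip (M : ℝ) : LipschitzWith 1 (clip M) :=
  (LipschitzWith.id.const_min M).const_max (-M)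

theorem clip_mem_Icc {M : ℝ} (hM : 0 ≤ M) (s : ℝ) : clip M s ∈ Icc (-M) M :=
  ⟨le_max_left _ _, max_le (by linarith) (min_le_left _ _)⟩

theorem clip_of_abs_le {M s : ℝ} (h : |s| ≤ M) : clip M s = s := by
  rw [abs_le] at h
  rw [clip, min_eq_right h.2, max_eq_right h.1]

theorem enorm_clip_sub_clip_le (M s t : ℝ) : ‖clip M s - clip M t‖ₑ ≤ ‖s - t‖ₑ := by
  simpa [edist_eq_enorm_sub] using (lipschitzWith_clip M).edist_le_mul s t

theorem enorm_clip_le {M : ℝ} (hM : 0 ≤ M) (s : ℝ) : ‖clip M s‖ₑ ≤ ‖s‖ₑ := by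
  simpa [clip_of_abs_le (s := 0) (M := M) (by simpa using hM)] using enorm_clip_sub_clip_le M s 0

theorem enorm_clip_sub_clip_le_const {M : ℝ} (hM : 0 ≤ M) (s t : ℝ) :
    ‖clip M s - clip M t‖ₑ ≤ ENNReal.ofReal (2 * M) := by
  rw [Real.enorm_eq_ofReal_abs]
  refine ENNReal.ofReal_le_ofReal ?_
  have h1 := clip_mem_Icc hM s
  have h2 := clip_mem_Icc hM t
  rw [abs_le]
  constructor <;> linarith [h1.1, h1.2, h2.1, h2.2]

variable {X : Type*} [MetricSpace X]

theorem asympLip_clip_le (M : ℝ) (u : X → ℝ) (x : X) :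
    asympLip (fun y => clip M (u y)) x ≤ asympLip u x :=
  asympLip_mono_of_eventually <| Eventually.of_forall fun p => by
    simpa [Real.dist_eq] using (lipschitzWith_clip M).dist_le_mul (u p.1) (u p.2)

theorem locallyLipschitzOn_clip {A : Set X} {u : X → ℝ} (hu : LocallyLipschitzOn A u) (M : ℝ) :
    LocallyLipschitzOn A fun y => clip M (u y) := fun _ hx =>
  let ⟨K, t, ht, hK⟩ := hu hx
  ⟨1 * K, t, ht, (lipschitzWith_clip M).comp_lipschitzOnWith hK⟩

variable [MeasurableSpace X] [BorelSpace X]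

/-- Truncation improves local `L¹` convergence to `L¹` convergence if the measure is finite. -/
theorem TendstoL1Loc.tendsto_clip [SecondCountableTopology X] {ν : Measure X} [IsFiniteMeasure ν]
    {A : Set X} (hA : IsOpen A) (hνA : ν Aᶜ = 0) {u : ℕ → X → ℝ} {f : X → ℝ}
    (h : TendstoL1Loc ν A u f) {M : ℝ} (hM : 0 ≤ M) :
    Tendsto (fun n => ∫⁻ x, ‖clip M (u n x) - clip M (f x)‖ₑ ∂ν) atTop (𝓝 0) := by
  obtain rfl | hne := A.eq_empty_or_nonempty
  · rw [compl_empty, Measure.measure_univ_eq_zero] at hνA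
    simp [hνA]
  choose! U hU hUt using h
  -- By the Lindelöf property finitely many good neighbourhoods cover all but a small measure; on
  -- the rest the truncated difference is at most `2 * M`.
  obtain ⟨t, htA, htc, hAt⟩ := TopologicalSpace.countable_cover_nhdsWithin
    (f := fun x => interior (U x) ∩ A) (s := A) fun x hx =>
      inter_mem (mem_nhdsWithin_of_mem_nhds (interior_mem_nhds.2 (hU x hx))) self_mem_nhdsWithin
  have htne : t.Nonempty := by
    obtain ⟨x, hx⟩ := hne
    obtain ⟨y, hy, -⟩ := mem_iUnion₂.1 (hAt hx)
    exact ⟨y, hy⟩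
  obtain ⟨e, rfl⟩ := htc.exists_eq_range htne
  set V : ℕ → Set X := fun i => interior (U (e i)) ∩ A with hV
  have hVm : ∀ i, MeasurableSet (V i) := fun i => (isOpen_interior.inter hA).measurableSet
  have hVt : ∀ i, Tendsto (fun n => ∫⁻ x in V i, ‖u n x - f x‖ₑ ∂ν) atTop (𝓝 0) := fun i =>
    tendsto_of_tendsto_of_tendsto_of_le_of_le tendsto_const_nhds (hUt (e i) (htA ⟨i, rfl⟩))
      (fun _ => zero_le) fun n => lintegral_mono_set (inter_subset_inter_left _ interior_subset)
  have hacc : ∀ N, Tendsto (fun n => ∫⁻ x in accumulate V N, ‖u n x - f x‖ₑ ∂ν) atTop (𝓝 0) := by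
    intro N
    induction N with
    | zero => simpa [accumulate_zero_nat] using hVt 0
    | succ N ih =>
      rw [accumulate_succ]
      exact tendsto_of_tendsto_of_tendsto_of_le_of_le tendsto_const_nhds
        (by simpa using ih.add (hVt (N + 1))) (fun _ => zero_le) fun n => lintegral_union_le _ _ _
  have haccm : ∀ N, MeasurableSet (accumulate V N) := fun N =>
    MeasurableSet.biUnion (to_countable _) fun i _ => hVm i
  have hcompl : Tendsto (fun N => ν (accumulate V N)ᶜ) atTop (𝓝 0) := by
    have h1 := tendsto_measure_iInter_atTop (μ := ν) (s := fun N => (accumulate V N)ᶜ)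
      (fun N => (haccm N).compl.nullMeasurableSet)
      (fun i j hij => compl_subset_compl.2 (monotone_accumulate hij)) ⟨0, measure_ne_top _ _⟩
    have h2 : ν (⋂ N, (accumulate V N)ᶜ) = 0 := by
      refine measure_mono_null ?_ hνA
      rw [← compl_iUnion, iUnion_accumulate]
      refine compl_subset_compl.2 (hAt.trans ?_)
      simp [hV]
    rwa [h2] at h1
  rw [ENNReal.tendsto_nhds_zero]
  intro ε hε
  have hcM : Tendsto (fun N => ENNReal.ofReal (2 * M) * ν (accumulate V N)ᶜ) atTop (𝓝 0) := by
    rw [← mul_zero (ENNReal.ofReal (2 * M))]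
    exact ENNReal.Tendsto.const_mul hcompl (Or.inr ENNReal.ofReal_ne_top)
  obtain ⟨N, hN⟩ := (hcM.eventually_le_const (ENNReal.half_pos hε.ne')).exists
  filter_upwards [(hacc N).eventually_le_const (ENNReal.half_pos hε.ne')] with n hn
  rw [← lintegral_add_compl _ (haccm N), ← ENNReal.add_halves ε]
  refine add_le_add ((lintegral_mono fun x => enorm_clip_sub_clip_le M _ _).trans hn) ?_
  refine (lintegral_mono fun x => enorm_clip_sub_clip_le_const hM _ _).trans ?_
  rwa [setLIntegral_const]

end truncation

theorem lintegral_enorm_indicator_sub_indicator {X : Type*} [MeasurableSpace X] {m : Measure X}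
    {G : Set X} (hG : MeasurableSet G) (f g : X → ℝ) :
    ∫⁻ x, ‖G.indicator f x - G.indicator g x‖ₑ ∂m = ∫⁻ x in G, ‖f x - g x‖ₑ ∂m := by
  rw [← lintegral_indicator hG]
  refine lintegral_congr fun x => ?_
  by_cases hx : x ∈ G <;> simp [hx]

section zeroExtension

variable {X : Type*} [MetricSpace X] [MeasurableSpace X] [BorelSpace X] {m : Measure X}
  {G A : Set X}

theorem relaxedEnergy_indicator_le_of_bounded [SFinite m] (hG : IsClosed G) (hGm : m G ≠ ∞)
    (hP : perimeter m G ≠ ∞) {c : ℝ≥0}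
    (hmin : ∀ G' ⊆ G, IsClosed G' → perimeter m G ≤ perimeter m G' + c * m (G \ G'))
    (hA : IsOpen A) (hGA : G ⊆ A) {u : X → ℝ} (hu : LocallyLipschitzOn A u) {M : ℝ}
    (hM : ∀ x, u x ∈ Icc (-M) M) : relaxedEnergy m (G.indicator u) ≤
      2 * (2 * ∫⁻ x in G, asympLip u x ∂m + c * ∫⁻ x in G, ‖u x‖ₑ ∂m) := by
  -- This covers positive and negative parts at once; adding the two bounds gives the outer factor
  -- 2.
  have key : ∀ φ : ℝ → ℝ, LipschitzWith 1 φ → (∀ s ∈ Icc (-M) M, φ s ∈ Icc 0 M) →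
      (∀ s, |φ s| ≤ |s|) → relaxedEnergy m (G.indicator fun x => φ (u x)) ≤
        2 * ∫⁻ x in G, asympLip u x ∂m + c * ∫⁻ x in G, ‖u x‖ₑ ∂m := by
    intro φ hφ hφM hφs
    refine (relaxedEnergy_indicator_le_of_nonneg hG hGm hP hmin hA hGA (M := M)
      (u := fun x => φ (u x)) (fun x hx => ?_) fun x => hφM _ (hM x)).trans ?_
    · obtain ⟨K, t, ht, hK⟩ := hu hx
      exact ⟨1 * K, t, ht, hφ.comp_lipschitzOnWith hK⟩
    · gcongr with x x
      · exact asympLip_mono_of_eventually <| Eventually.of_forall fun p => by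
          simpa [Real.dist_eq] using hφ.dist_le_mul (u p.1) (u p.2)
      · rw [Real.enorm_eq_ofReal_abs, Real.enorm_eq_ofReal_abs]
        exact ENNReal.ofReal_le_ofReal (hφs _)
  have e : G.indicator u = fun x =>
      G.indicator (fun y => max 0 (u y)) x - G.indicator (fun y => max 0 (-u y)) x := by
    ext x
    by_cases hx : x ∈ G
    · simp only [indicator_of_mem hx]
      rw [max_comm, max_comm 0, max_zero_sub_max_neg_zero_eq_self]
    · simp [hx]
  rw [e, two_mul]
  refine (relaxedEnergy_sub_le ?_).trans (add_le_add
    (key (fun s => max 0 s) (LipschitzWith.id.const_max 0) (fun s hs => ?_) fun s => ?_)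
    (key (fun s => max 0 (-s)) ?_ (fun s hs => ?_) fun s => ?_))
  · exact (measurable_indicator_of_continuousOn hG.measurableSet (continuousOn_const.sup
      (hu.continuousOn.mono hGA))).aestronglyMeasurable
  · exact ⟨le_max_left _ _, max_le (by linarith [hs.1, hs.2]) hs.2⟩
  · rw [abs_of_nonneg (le_max_left _ _)]; exact max_le (abs_nonneg _) (le_abs_self _)
  · exact LipschitzWith.id.neg.const_max 0
  · exact ⟨le_max_left _ _, max_le (by linarith [hs.1, hs.2]) (by linarith [hs.1])⟩
  · rw [abs_of_nonneg (le_max_left _ _)]; exact max_le (abs_nonneg _) (neg_le_abs _)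

variable [SecondCountableTopology X]

theorem relaxedEnergy_indicator_clip_le [SFinite m] (hG : IsClosed G) (hGm : m G ≠ ∞)
    (hP : perimeter m G ≠ ∞) {c : ℝ≥0}
    (hmin : ∀ G' ⊆ G, IsClosed G' → perimeter m G ≤ perimeter m G' + c * m (G \ G'))
    {f : X → ℝ} (hf : MemBV m G f) {M : ℝ} (hM : 0 ≤ M) :
    relaxedEnergy m (G.indicator fun x => clip M (f x)) ≤
      2 * (2 * variation (m.restrict G) f G + c * ∫⁻ x in G, ‖f x‖ₑ ∂m) := by
  have hcm : AEStronglyMeasurable (fun x => clip M (f x)) (m.restrict G) :=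
    (lipschitzWith_clip M).continuous.comp_aestronglyMeasurable hf.integrable.1
  refine relaxedEnergy_le_of_approx
    ((aestronglyMeasurable_indicator_iff hG.measurableSet).2 hcm) fun δ hδ => ?_
  -- Errors `η` in the variation and in the L¹ norm enter the final bound with coefficients 4 and `2
  -- * c`.
  set η : ℝ≥0∞ := δ / (4 + 2 * c) with hη
  have hη0 : η ≠ 0 := ENNReal.div_ne_zero.2 ⟨hδ, by finiteness⟩
  have hηδ : (4 + 2 * c) * η = δ := ENNReal.mul_div_cancel (by simp) (by finiteness)
  have hηle : η ≤ δ := by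
    rw [← hηδ]
    exact le_mul_of_one_le_left zero_le (le_add_right (by norm_num))
  have hlt := ENNReal.lt_add_right hf.variation_lt_top.ne hη0
  conv_lhs at hlt => rw [variation]
  simp only [iInf_lt_iff, variationOpen] at hlt
  obtain ⟨A, hA, hGA, u, hu, huf, hlt⟩ := hlt
  have : IsFiniteMeasure (m.restrict G) := ⟨by simpa using hGm.lt_top⟩
  have hAc : (m.restrict G) Aᶜ = 0 := by
    rw [Measure.restrict_apply hA.measurableSet.compl, disjoint_iff_inter_eq_empty.1
      (disjoint_compl_left_iff_subset.2 hGA), measure_empty]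
  obtain ⟨n, hn, hn'⟩ := ((frequently_lt_of_liminf_lt (by isBoundedDefault) hlt).and_eventually
    ((huf.tendsto_clip hA hAc hM).eventually_le_const hη0.bot_lt)).exists
  rw [Measure.restrict_restrict hA.measurableSet, inter_eq_self_of_subset_right hGA] at hn
  have hcl := locallyLipschitzOn_clip (hu n) M
  refine ⟨G.indicator fun x => clip M (u n x), (measurable_indicator_of_continuousOn
    hG.measurableSet (hcl.continuousOn.mono hGA)).aestronglyMeasurable, ?_, ?_⟩
  · rw [lintegral_enorm_indicator_sub_indicator hG.measurableSet]
    exact hn'.trans hηle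
  · have hnorm : ∫⁻ x in G, ‖clip M (u n x)‖ₑ ∂m ≤ η + ∫⁻ x in G, ‖f x‖ₑ ∂m := by
      have h1 := lintegral_enorm_sub_le (u := fun x => clip M (u n x)) (f := fun _ => 0) hcm
        aestronglyMeasurable_const
      simp only [sub_zero] at h1
      exact h1.trans (add_le_add hn' (lintegral_mono fun x => enorm_clip_le hM _))
    calc _ ≤ _ := relaxedEnergy_indicator_le_of_bounded hG hGm hP hmin hA hGA hcl
          fun x => clip_mem_Icc hM _
      _ ≤ 2 * (2 * (variation (m.restrict G) f G + η) + c * (η + ∫⁻ x in G, ‖f x‖ₑ ∂m)) := by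
        gcongr
        exact (lintegral_mono fun x => asympLip_clip_le M _ x).trans hn.le
      _ = 2 * (2 * variation (m.restrict G) f G + c * ∫⁻ x in G, ‖f x‖ₑ ∂m) +
          (4 + 2 * c) * η := by ring
      _ = _ := by rw [hηδ]

/-- The bound for truncations does not depend on the level, so it survives the L¹ limit as the level
tends to infinity. -/
theorem relaxedEnergy_indicator_le [SFinite m] (hG : IsClosed G) (hGm : m G ≠ ∞)
    (hP : perimeter m G ≠ ∞) {c : ℝ≥0}
    (hmin : ∀ G' ⊆ G, IsClosed G' → perimeter m G ≤ perimeter m G' + c * m (G \ G'))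
    {f : X → ℝ} (hf : MemBV m G f) : relaxedEnergy m (G.indicator f) ≤
      2 * (2 * variation (m.restrict G) f G + c * ∫⁻ x in G, ‖f x‖ₑ ∂m) := by
  have hcm : ∀ n : ℕ, AEStronglyMeasurable (fun x => clip n (f x)) (m.restrict G) := fun n =>
    (lipschitzWith_clip n).continuous.comp_aestronglyMeasurable hf.integrable.1
  have ht : Tendsto (fun n : ℕ => ∫⁻ x in G, ‖clip n (f x) - f x‖ₑ ∂m) atTop (𝓝 0) := by
    have key := tendsto_lintegral_of_dominated_convergence' (μ := m.restrict G)
      (F := fun (n : ℕ) x => ‖clip n (f x) - f x‖ₑ) (f := fun _ => 0)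
      (fun x => ‖f x‖ₑ + ‖f x‖ₑ) (fun n => ((hcm n).sub hf.integrable.1).enorm)
      (fun n => Eventually.of_forall fun x => enorm_sub_le.trans
        (add_le_add_left (enorm_clip_le n.cast_nonneg _) _)) ?_
      (Eventually.of_forall fun x => ?_)
    · simpa using key
    · rw [lintegral_add_left' hf.integrable.1.enorm]
      exact ENNReal.add_ne_top.2 ⟨hf.integrable.2.ne, hf.integrable.2.ne⟩
    · refine tendsto_const_nhds.congr' ?_
      filter_upwards [eventually_ge_atTop ⌈|f x|⌉₊] with n hn
      rw [clip_of_abs_le (Nat.ceil_le.1 hn), sub_self, enorm_zero]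
  refine relaxedEnergy_le_of_approx ((aestronglyMeasurable_indicator_iff hG.measurableSet).2
    hf.integrable.1) fun δ hδ => ?_
  obtain ⟨n, hn⟩ := (ht.eventually_le_const hδ.bot_lt).exists
  refine ⟨G.indicator fun x => clip n (f x),
    (aestronglyMeasurable_indicator_iff hG.measurableSet).2 (hcm n), ?_,
    (relaxedEnergy_indicator_clip_le hG hGm hP hmin hf n.cast_nonneg).trans le_self_add⟩
  rwa [lintegral_enorm_indicator_sub_indicator hG.measurableSet]

theorem zeroExtensionBounded_of_minimizer [SFinite m] (hG : IsClosed G) (hGm : m G ≠ ∞)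
    (hP : perimeter m G ≠ ∞) {c : ℝ≥0}
    (hmin : ∀ G' ⊆ G, IsClosed G' → perimeter m G ≤ perimeter m G' + c * m (G \ G')) :
    ZeroExtensionBounded m G := by
  -- The L¹ norm enters with coefficient `1 + 2 * c` and the variation with 4; this constant
  -- dominates both.
  refine ⟨5 + 2 * c, fun f hf => ?_⟩
  have hW := relaxedEnergy_indicator_le hG hGm hP hmin hf
  have hV : variation (m.restrict univ) (G.indicator f) univ ≤ _ :=
    variation_univ_le_relaxedEnergy.trans hW
  have hfin : ∫⁻ x in G, ‖f x‖ₑ ∂m ≠ ∞ := hf.integrable.2.ne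
  have hVf := hf.variation_lt_top.ne
  refine ⟨⟨?_, hV.trans_lt (by finiteness)⟩, ?_⟩
  · rw [Measure.restrict_univ, integrable_indicator_iff hG.measurableSet]
    exact hf.integrable
  · rw [bvNorm, bvNorm, eLpNorm_one_eq_lintegral_enorm, eLpNorm_one_eq_lintegral_enorm]
    have e : ∫⁻ x in univ, ‖G.indicator f x‖ₑ ∂m = ∫⁻ x in G, ‖f x‖ₑ ∂m := by
      simpa using lintegral_enorm_indicator_sub_indicator (m := m) hG.measurableSet f fun _ => 0
    rw [e]
    refine (add_le_add_right hV _).trans ?_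
    push_cast
    calc _ = (1 + 2 * c) * ∫⁻ x in G, ‖f x‖ₑ ∂m + 4 * variation (m.restrict G) f G := by ring
      _ ≤ (5 + 2 * c) * ∫⁻ x in G, ‖f x‖ₑ ∂m +
          (5 + 2 * c) * variation (m.restrict G) f G := by
        gcongr
        · norm_num
        · exact le_add_right (by norm_num)
      _ = _ := by ring

end zeroExtension

end MetricBV

/-! ### Approximation of a bounded Borel set -/

theorem corollary3p5 {X : Type*} [MetricSpace X] [CompleteSpace X]
    [TopologicalSpace.SeparableSpace X] [MeasurableSpace X] [BorelSpace X]
    (m : Measure X) (hm : ∀ s : Set X, Bornology.IsBounded s → m s < ∞)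
    (F : Set X) (hF : MeasurableSet F) (hFb : Bornology.IsBounded F)
    (ε : ℝ) (hε : 0 < ε) :
    ∃ G : Set X, IsClosed G ∧ m (symmDiff F G) < ENNReal.ofReal ε ∧
      MetricBV.ZeroExtensionBounded m G := by
  have : SecondCountableTopology X := UniformSpace.secondCountable_of_separable X
  have : IsLocallyFiniteMeasure m :=
    ⟨fun x => ⟨_, Metric.ball_mem_nhds x one_pos, hm _ Metric.isBounded_ball⟩⟩
  -- One third each for the inner closed set, its enlargement to finite perimeter, and the mass
  -- removed by minimization.
  set e : ℝ≥0∞ := ENNReal.ofReal ε / 3 with he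
  have he0 : e ≠ 0 := ENNReal.div_ne_zero.2 ⟨by simpa using hε, by finiteness⟩
  obtain ⟨K, hKF, hK, hFK⟩ := hF.exists_isClosed_sdiff_lt (hm F hFb).ne he0
  obtain ⟨G₀, hKG₀, hG₀, hmG₀, hPG₀, hG₀K⟩ :=
    MetricBV.exists_isClosed_perimeter_ne_top hm hK (hFb.subset hKF) he0
  have hquot : MetricBV.perimeter m G₀ / e ≠ ∞ := ENNReal.div_ne_top hPG₀ he0
  -- With `c` above `perimeter m G₀ / e`, the bound of `c * m (G₀ \ G)` by `perimeter m G₀` leaves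
  -- less than `e` removed.
  obtain ⟨c, hc, -⟩ := ENNReal.lt_iff_exists_nnreal_btwn.1 hquot.lt_top
  obtain ⟨G, hGG₀, hG, hle, hmin⟩ := MetricBV.exists_isClosed_minimizer hG₀ hmG₀ hPG₀ c
  have hG₀G : m (G₀ \ G) < e := by
    by_contra! h
    have h1 : MetricBV.perimeter m G₀ < c * e := by
      rwa [ENNReal.div_lt_iff (Or.inl he0) (Or.inr hPG₀)] at hc
    have h2 : c * e ≤ MetricBV.perimeter m G₀ :=
      (mul_le_mul_right h _).trans (le_add_self.trans hle)
    exact absurd h1 (not_lt.2 h2)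
  refine ⟨G, hG, ?_, MetricBV.zeroExtensionBounded_of_minimizer hG
    (measure_ne_top_of_subset hGG₀ hmG₀) (ne_top_of_le_ne_top hPG₀ (le_self_add.trans hle)) hmin⟩
  have hsub : symmDiff F G ⊆ (F \ K) ∪ (G₀ \ K) ∪ (G₀ \ G) := by
    rintro x (⟨hxF, hxG⟩ | ⟨hxG, hxF⟩)
    · by_cases hxK : x ∈ K
      · exact Or.inr ⟨hKG₀ hxK, hxG⟩
      · exact Or.inl (Or.inl ⟨hxF, hxK⟩)
    · exact Or.inl (Or.inr ⟨hGG₀ hxG, fun h => hxF (hKF h)⟩)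
  calc m (symmDiff F G) ≤ m (F \ K) + m (G₀ \ K) + m (G₀ \ G) :=
        (measure_mono hsub).trans ((measure_union_le _ _).trans
          (add_le_add_left (measure_union_le _ _) _))
    _ < e + e + e := ENNReal.add_lt_add (ENNReal.add_lt_add hFK hG₀K) hG₀G
    _ = ENNReal.ofReal ε := ENNReal.add_thirds _
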